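/- Let $d\ge 5$ be odd, and let $|0\rangle,\dots,|d-1\rangle$ be the standard basis of $\mathbb C^d$. A set of pairwise orthogonal nonzero product vectors in $\mathbb C^d\otimes\mathbb C^d$ (vectors are not normalized) is a UPB (unextendible product basis) if its span is a proper subspace whose orthogonal complement contains no nonzero product vector. A density matrix is separable if it is a finite convex combination of tensor products $\rho_A\otimes\rho_B$ of density matrices, and entangled otherwise. The Peres set $\mathcal P$ is the convex set of density matrices on $\mathbb C^d\otimes\mathbb C^d$ with positive semidefinite partial transpose; a PPT bound entangled (PPT-BE) state is an entangled element of $\mathcal P$. For $0\le k\le (d-1)/2$ put $a_k=\frac{d-1}2-k$, $b_k=\frac{d-1}2+k$ and $|T_k\rangle=\sum_{i,j=a_k}^{b_k}|i\rangle|j\rangle$. For $1\le k\le (d-1)/2$ and $f:\mathbb N\to\mathbb C$ consider the four product vectors $$\psi^{(1)}_k(f)=|a_k\rangle\sum_{j=a_k}^{b_k-1}f(j)|j\rangle,\quad \psi^{(2)}_k(f)=|b_k\rangle\sum_{j=a_k+1}^{b_k}f(j)|j\rangle,\quad \psi^{(3)}_k(f)=\sum_{j=a_k}^{b_k-1}f(j)|j\rangle\,|b_k\rangle,\quad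 \psi^{(4)}_k(f)=\sum_{j=a_k+1}^{b_k}f(j)|j\rangle\,|a_k\rangle .$$ The generalized Tiles set consists of the stopper $|S\rangle=\sum_{i,j=0}^{d-1}|i\rangle|j\rangle$ and of all vectors $\psi^{(t)}_k(j\mapsto\omega_k^{jk'})$ with $1\le k\le (d-1)/2$, $1\le k'\le 2k-1$, $1\le t\le 4$, where $\omega_k=e^{\pi i/k}$. Let $\mathcal H_E$ be the orthogonal complement of its span and $\rho_d$ the orthogonal projector onto $\mathcal H_E$ divided by $\dim\mathcal H_E$. For $1\le k\le (d-1)/2$ write $\psi^{(t)}_k=\psi^{(t)}_k(1)$ and let $$\phi_{k,1}=\psi^{(1)}_k+\psi^{(2)}_k-\psi^{(3)}_k-\psi^{(4)}_k,\quad \phi_{k,2}=\psi^{(1)}_k-\psi^{(2)}_k+\psi^{(3)}_k-\psi^{(4)}_k,\quad \phi_{k,3}=\psi^{(1)}_k-\psi^{(2)}_k-\psi^{(3)}_k+\psi^{(4)}_k,$$ $$\phi_{k,4}=(2k-1)^2\big(\psi^{(1)}_k+\psi^{(2)}_k+\psi^{(3)}_k+\psi^{(4)}_k\big)-8k\,|T_{k-1}\rangle,\qquad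 \sigma_k=\frac14\sum_{i=1}^4\frac{|\phi_{k,i}\rangle\langle\phi_{k,i}|}{\langle\phi_{k,i}|\phi_{k,i}\rangle}.$$ Theorem. The generalized Tiles set is a UPB with exactly $(d-1)^2+1$ members, $\dim\mathcal H_E=2(d-1)$, and $\rho_d$ is a PPT-BE state. It has the decomposition $$\rho_d=\frac{2}{d-1}\sum_{k=1}^{(d-1)/2}\sigma_k ,$$ in which every $\sigma_k$ is a PPT-BE state of rank $4$ and an extreme point of the Peres set $\mathcal P$ of $\mathbb C^d\otimes\mathbb C^d$. -/

import Mathlib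

open scoped Kronecker ComplexOrder

noncomputable section

namespace TilesUPB

section General

variable {m n : Type*} [Fintype m] [Fintype n]

/-- The product vector `|a⟩|b⟩` in `ℂ^m ⊗ ℂ^n`, the latter being realized as the Euclidean space
on the index set `m × n`. -/
def prodKet (a : EuclideanSpace ℂ m) (b : EuclideanSpace ℂ n) : EuclideanSpace ℂ (m × n) :=
  WithLp.toLp 2 fun p => a p.1 * b p.2

/-- An (unnormalized) pure product state: a nonzero vector of the form `|a⟩|b⟩`. -/
def IsProductKet (v : EuclideanSpace ℂ (m × n)) : Prop :=
  v ≠ 0 ∧ ∃ (a : EuclideanSpace ℂ m) (b : EuclideanSpace ℂ n), v = prodKet a b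

/-- An unextendible product basis: a set of pairwise orthogonal pure product states which spans a
proper subspace whose orthogonal complement contains no product state. -/
structure IsUPB (U : Set (EuclideanSpace ℂ (m × n))) : Prop where
  product : ∀ v ∈ U, IsProductKet v
  orthogonal : ∀ v ∈ U, ∀ w ∈ U, v ≠ w → inner ℂ v w = 0
  incomplete : Submodule.span ℂ U ≠ ⊤
  unextendible : ∀ v ∈ (Submodule.span ℂ U)ᗮ, ¬ IsProductKet v

/-- Density matrices: positive semidefinite (in particular Hermitian) with trace one. -/
structure IsDensity (ρ : Matrix m m ℂ) : Prop where
  posSemidef : ρ.PosSemidef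
  trace_eq_one : ρ.trace = 1

/-- Separable states: finite convex combinations of products of density matrices. -/
def IsSeparable (ρ : Matrix (m × n) (m × n) ℂ) : Prop :=
  ∃ (N : ℕ) (p : Fin N → ℝ) (A : Fin N → Matrix m m ℂ) (B : Fin N → Matrix n n ℂ),
    (∀ i, 0 ≤ p i) ∧ ∑ i, p i = 1 ∧ (∀ i, IsDensity (A i)) ∧ (∀ i, IsDensity (B i)) ∧
      ρ = ∑ i, (p i : ℂ) • (A i ⊗ₖ B i)

/-- Partial transposition on the second tensor factor, in the standard basis. -/
def partialTranspose (ρ : Matrix (m × n) (m × n) ℂ) : Matrix (m × n) (m × n) ℂ :=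
  Matrix.of fun x y => ρ (x.1, y.2) (y.1, x.2)

variable (m n) in
/-- The Peres set: all density matrices on `ℂ^m ⊗ ℂ^n` with positive semidefinite partial
transpose. -/
def peresSet : Set (Matrix (m × n) (m × n) ℂ) :=
  {ρ | IsDensity ρ ∧ (partialTranspose ρ).PosSemidef}

/-- PPT bound entangled states: PPT states which are entangled, i.e. not separable. -/
def IsPPTBoundEntangled (ρ : Matrix (m × n) (m × n) ℂ) : Prop :=
  ρ ∈ peresSet m n ∧ ¬ IsSeparable ρ

/-- The rank-one projector `|v⟩⟨v| / ⟨v|v⟩` onto the line of a nonzero vector `v`. -/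
def pureState (v : EuclideanSpace ℂ m) : Matrix m m ℂ :=
  ((‖v‖ ^ 2 : ℝ) : ℂ)⁻¹ • Matrix.vecMulVec (fun i => v i) (fun i => star (v i))

/-- The normalized projector onto a subspace `K`: the matrix, in the standard basis, of the
orthogonal projector onto `K`, divided by `dim K`. -/
def normalizedProjector [DecidableEq m] (K : Submodule ℂ (EuclideanSpace ℂ m)) : Matrix m m ℂ :=
  (Module.finrank ℂ K : ℂ)⁻¹ •
    Matrix.toEuclideanLin.symm (K.starProjection : EuclideanSpace ℂ m →ₗ[ℂ] EuclideanSpace ℂ m)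

end General

/-! The tile structure for odd `d`. Rows and columns are numbered `0, …, d - 1`, the centre is
`(d - 1) / 2`, and layer `k`, for `1 ≤ k ≤ (d - 1) / 2`, is the boundary of the square
`{lo d k, …, hi d k} × {lo d k, …, hi d k}`, cut into four tiles of `2 k` cells each. -/

/-- The first index of layer `k`. -/
def lo (d k : ℕ) : ℕ := (d - 1) / 2 - k

/-- The last index of layer `k`. -/
def hi (d k : ℕ) : ℕ := (d - 1) / 2 + k

/-- The vector `∑_{j = a}^{b} f j |j⟩` of `ℂ^d`. -/
def rangeKet (d a b : ℕ) (f : ℕ → ℂ) : EuclideanSpace ℂ (Fin d) :=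
  WithLp.toLp 2 fun j => if a ≤ (j : ℕ) ∧ (j : ℕ) ≤ b then f j else 0

/-- The basis vector `|a⟩` of `ℂ^d`. -/
def ket (d a : ℕ) : EuclideanSpace ℂ (Fin d) := rangeKet d a a fun _ => 1

/-- The product vector supported on the `t`-th tile of layer `k` with amplitudes `f`. -/
def tileKet (d k : ℕ) (f : ℕ → ℂ) : Fin 4 → EuclideanSpace ℂ (Fin d × Fin d)
  | 0 => prodKet (ket d (lo d k)) (rangeKet d (lo d k) (hi d k - 1) f)
  | 1 => prodKet (ket d (hi d k)) (rangeKet d (lo d k + 1) (hi d k) f)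
  | 2 => prodKet (rangeKet d (lo d k) (hi d k - 1) f) (ket d (hi d k))
  | 3 => prodKet (rangeKet d (lo d k + 1) (hi d k) f) (ket d (lo d k))

/-- The amplitudes `j ↦ ω ^ (j k')` with `ω = exp (π i / k)`. -/
def fourier (k k' : ℕ) (j : ℕ) : ℂ := Complex.exp (Real.pi * Complex.I / k) ^ (j * k')

/-- The vector `|lo + ⋯ + hi⟩|lo + ⋯ + hi⟩`, constant on the square enclosed by layer `k`;
for `k = 0` it is the central tile state. -/
def squareKet (d k : ℕ) : EuclideanSpace ℂ (Fin d × Fin d) :=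
  prodKet (rangeKet d (lo d k) (hi d k) fun _ => 1) (rangeKet d (lo d k) (hi d k) fun _ => 1)

/-- The stopper `|S⟩ = |0 + ⋯ + (d - 1)⟩|0 + ⋯ + (d - 1)⟩`. -/
def stopper (d : ℕ) : EuclideanSpace ℂ (Fin d × Fin d) :=
  prodKet (rangeKet d 0 (d - 1) fun _ => 1) (rangeKet d 0 (d - 1) fun _ => 1)

/-- The generalized Tiles UPB: the stopper together with `2 k - 1` states from each of the four
tiles of each layer `k`. -/
def tilesUPB (d : ℕ) : Set (EuclideanSpace ℂ (Fin d × Fin d)) :=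
  {v | v = stopper d ∨ ∃ k ∈ Finset.Icc 1 ((d - 1) / 2), ∃ k' ∈ Finset.Icc 1 (2 * k - 1),
    ∃ t : Fin 4, v = tileKet d k (fourier k k') t}

/-- The entangled subspace: the orthogonal complement of the span of the Tiles UPB. -/
def entangledSubspace (d : ℕ) : Submodule ℂ (EuclideanSpace ℂ (Fin d × Fin d)) :=
  (Submodule.span ℂ (tilesUPB d))ᗮ

/-- The normalized projector onto the entangled subspace. -/
def rho (d : ℕ) : Matrix (Fin d × Fin d) (Fin d × Fin d) ℂ :=
  normalizedProjector (entangledSubspace d)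

/-- The missing state of the `t`-th tile of layer `k`: all amplitudes are one. -/
def missing (d k : ℕ) (t : Fin 4) : EuclideanSpace ℂ (Fin d × Fin d) :=
  tileKet d k (fun _ => 1) t

/-- The four entangled states attached to layer `k`. The last one combines the sum of the missing
states of the layer with the constant vector on the square inside it, the coefficients being, up to
a common factor, those which make it orthogonal to the stopper. -/
def entKet (d k : ℕ) : Fin 4 → EuclideanSpace ℂ (Fin d × Fin d)
  | 0 => missing d k 0 + missing d k 1 - missing d k 2 - missing d k 3
  | 1 => missing d k 0 - missing d k 1 + missing d k 2 - missing d k 3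
  | 2 => missing d k 0 - missing d k 1 - missing d k 2 + missing d k 3
  | 3 => (2 * (k : ℂ) - 1) ^ 2 •
        (missing d k 0 + missing d k 1 + missing d k 2 + missing d k 3)
      - (8 * (k : ℂ)) • squareKet d (k - 1)

/-- The equal mixture of the four normalized entangled states attached to layer `k`. -/
def sigma (d k : ℕ) : Matrix (Fin d × Fin d) (Fin d × Fin d) ℂ :=
  (1 / 4 : ℂ) • ∑ i, pureState (entKet d k i)

end TilesUPB

end

noncomputable section

namespace TilesUPB

/-! ### Product vectors, pure states and separability in general dimensions. -/

section General

variable {m n : Type*}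

/-! A vector orthogonal to the Tiles basis is constant on every tile, because the nontrivial
characters are removed there, and its entries sum to zero, because of the stopper. If it is a
product, peel off the layers from outside: on the outermost layer of the support either both factors
vanish at the two ends, or each factor takes a single nonzero value, and then the total is nonzero
(`boundary_eq_zero`). Hence the basis is unextendible. The four vectors per layer are orthogonal,
lie in the entangled subspace and number `2 (d - 1)`, its dimension, so they span it
(`span_entFamily`); this gives the decomposition of the normalized projector.

Up to the factor `1/4`, `sigma d k` is a sum of projectors onto the four tile states and the inner
square, minus the projector onto the full square (`sigma_apply`). All of these are real product
vectors, so partial transposition fixes `sigma d k`. Its kernel contains the basis, so it is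
entangled by `IsUPB.not_isSeparable`; both properties pass to the average over the layers.

For extremality, a component of `sigma d k` in the Peres set has a kernel at least as large, and so
has its partial transpose. The difference `D` from `sigma d k` is thus given by a 5 × 5 array over
the four tiles and the inner square, and so is its partial transpose. Comparing the two arrays makes
all off-diagonal entries equal to one number `x`; the kernel vector fixes the diagonal in terms of
`x`, and the zero trace forces `x = 0` (`eq_zero_of_columnsConst`). -/

@[simp] lemma prodKet_apply (a : EuclideanSpace ℂ m) (b : EuclideanSpace ℂ n) (p : m × n) :
    prodKet a b p = a p.1 * b p.2 := rfl

lemma partialTranspose_apply (ρ : Matrix (m × n) (m × n) ℂ) (x y : m × n) :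
    partialTranspose ρ x y = ρ (x.1, y.2) (y.1, x.2) := rfl

lemma partialTranspose_sum {ι : Type*} (s : Finset ι) (ρ : ι → Matrix (m × n) (m × n) ℂ) :
    partialTranspose (∑ i ∈ s, ρ i) = ∑ i ∈ s, partialTranspose (ρ i) := by
  ext x y
  simp [partialTranspose_apply, Matrix.sum_apply]

variable [Fintype m] [Fintype n]

lemma inner_eq_sum (v w : EuclideanSpace ℂ m) : inner ℂ v w = ∑ i, star (v i) * w i := by
  rw [PiLp.inner_apply]
  exact Finset.sum_congr rfl fun i _ => by simp [mul_comm]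

lemma inner_prodKet (a c : EuclideanSpace ℂ m) (b e : EuclideanSpace ℂ n) :
    inner ℂ (prodKet a b) (prodKet c e) = inner ℂ a c * inner ℂ b e := by
  simp only [inner_eq_sum, prodKet_apply, Fintype.sum_prod_type, Finset.sum_mul_sum]
  refine Finset.sum_congr rfl fun i _ => Finset.sum_congr rfl fun j _ => ?_
  rw [star_mul']
  ring

/-! ### Pure states -/

lemma pureState_apply (v : EuclideanSpace ℂ m) (i j : m) :
    pureState v i j = (inner ℂ v v)⁻¹ * (v i * star (v j)) := by
  rw [inner_self_eq_norm_sq_to_K]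
  simp [pureState, Matrix.vecMulVec_apply]

lemma pureState_posSemidef (v : EuclideanSpace ℂ m) : (pureState v).PosSemidef := by
  refine (Matrix.posSemidef_vecMulVec_self_star (fun i => v i)).smul ?_
  rw [← Complex.ofReal_inv, Complex.zero_le_real]
  positivity

lemma trace_pureState {v : EuclideanSpace ℂ m} (hv : v ≠ 0) : (pureState v).trace = 1 := by
  have h : inner ℂ v v ≠ 0 := inner_self_ne_zero.2 hv
  simp only [Matrix.trace, Matrix.diag_apply, pureState_apply, ← Finset.mul_sum]
  rw [← inv_mul_cancel₀ h, inner_eq_sum]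
  exact congrArg _ (Finset.sum_congr rfl fun i _ => mul_comm _ _)

lemma pureState_mulVec (v w : EuclideanSpace ℂ m) (i : m) :
    (pureState v).mulVec w i = (inner ℂ v v)⁻¹ * inner ℂ v w * v i := by
  simp only [Matrix.mulVec, dotProduct, pureState_apply, inner_eq_sum v w, Finset.mul_sum,
    Finset.sum_mul]
  exact Finset.sum_congr rfl fun j _ => by ring

lemma isDensity_pureState {v : EuclideanSpace ℂ m} (hv : v ≠ 0) : IsDensity (pureState v) :=
  ⟨pureState_posSemidef v, trace_pureState hv⟩

lemma sum_pureState_mulVec_eq_zero {ι : Type*} (s : Finset ι) (φ : ι → EuclideanSpace ℂ m)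
    {w : EuclideanSpace ℂ m} (h : ∀ i ∈ s, inner ℂ (φ i) w = 0) :
    (∑ i ∈ s, pureState (φ i)).mulVec w = 0 := by
  rw [Matrix.sum_mulVec]
  refine Finset.sum_eq_zero fun i hi => funext fun x => ?_
  rw [pureState_mulVec, h i hi]
  simp

/-- The projector onto an orthogonal family has rank the size of the family. -/
lemma rank_sum_pureState {ι : Type*} [Fintype ι] [DecidableEq ι] (φ : ι → EuclideanSpace ℂ m)
    (h0 : ∀ i, φ i ≠ 0) (h : Pairwise fun i j => inner ℂ (φ i) (φ j) = 0) :
    (∑ i, pureState (φ i)).rank = Fintype.card ι := by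
  -- The columns of `A` are the normalized vectors, so `A` is an isometry and the sum of projectors
  -- is `A * Aᴴ`.
  let A : Matrix m ι ℂ := Matrix.of fun x i => ((‖φ i‖ : ℂ))⁻¹ * φ i x
  have h1 : A.conjTranspose * A = 1 := by
    ext i j
    have : (A.conjTranspose * A) i j = (‖φ i‖ : ℂ)⁻¹ * (‖φ j‖ : ℂ)⁻¹ * inner ℂ (φ i) (φ j) := by
      simp only [A, Matrix.mul_apply, Matrix.conjTranspose_apply, Matrix.of_apply, inner_eq_sum,
        Finset.mul_sum, star_mul', star_inv₀]
      refine Finset.sum_congr rfl fun x _ => ?_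
      simp only [Complex.star_def, Complex.conj_ofReal]
      ring
    rw [this]
    by_cases hij : i = j
    · subst hij
      have hn : (‖φ i‖ : ℂ) ≠ 0 := by simpa using h0 i
      rw [inner_self_eq_norm_sq_to_K, Matrix.one_apply_eq]
      simp only [Complex.coe_algebraMap]
      field_simp
    · rw [h hij, Matrix.one_apply_ne hij, mul_zero]
  have h2 : ∑ i, pureState (φ i) = A * A.conjTranspose := by
    ext x y
    simp only [A, Matrix.sum_apply, pureState_apply, Matrix.mul_apply, Matrix.conjTranspose_apply,
      Matrix.of_apply, star_mul', star_inv₀]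
    refine Finset.sum_congr rfl fun i _ => ?_
    rw [inner_self_eq_norm_sq_to_K]
    simp only [Complex.star_def, Complex.conj_ofReal, Complex.coe_algebraMap, sq, mul_inv]
    ring
  rw [h2, Matrix.rank_self_mul_conjTranspose, ← Matrix.rank_conjTranspose_mul_self, h1,
    Matrix.rank_one]

lemma normalizedProjector_span [DecidableEq m] {ι : Type*} [Fintype ι]
    (φ : ι → EuclideanSpace ℂ m) (h0 : ∀ i, φ i ≠ 0)
    (h : Pairwise fun i j => inner ℂ (φ i) (φ j) = 0) :
    normalizedProjector (Submodule.span ℂ (Set.range φ)) =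
      (Fintype.card ι : ℂ)⁻¹ • ∑ i, pureState (φ i) := by
  have hfin : Module.finrank ℂ (Submodule.span ℂ (Set.range φ)) = Fintype.card ι :=
    finrank_span_eq_card (linearIndependent_of_ne_zero_of_inner_eq_zero h0 h)
  rw [normalizedProjector, hfin]
  congr 1
  rw [LinearEquiv.symm_apply_eq]
  refine LinearMap.ext fun v => ?_
  have hv : Matrix.toEuclideanLin (∑ i, pureState (φ i)) v =
      ∑ i, ((inner ℂ (φ i) (φ i))⁻¹ * inner ℂ (φ i) v) • φ i := by
    ext x
    rw [Matrix.ofLp_toLpLin, Matrix.toLin'_apply, Matrix.sum_mulVec]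
    simp [pureState_mulVec]
  rw [hv]
  refine Submodule.eq_starProjection_of_mem_of_inner_eq_zero
    (Submodule.sum_mem _ fun i _ => Submodule.smul_mem _ _ (Submodule.subset_span ⟨i, rfl⟩)) ?_
  intro w hw
  refine inner_eq_zero_symm.1 ?_
  induction hw using Submodule.span_induction with
  | mem w hw =>
    obtain ⟨j, rfl⟩ := hw
    rw [inner_sub_right, inner_sum, Finset.sum_eq_single_of_mem j (Finset.mem_univ j)]
    · have : inner ℂ (φ j) (φ j) ≠ 0 := inner_self_ne_zero.2 (h0 j)
      rw [inner_smul_right]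
      field_simp
      simp
    · intro i _ hij
      rw [inner_smul_right, h hij.symm, mul_zero]
  | zero => simp
  | add x y _ _ hx hy => rw [inner_add_left, hx, hy, add_zero]
  | smul c x _ hx => rw [inner_smul_left, hx, mul_zero]

/-! ### Entanglement from an unextendible product basis -/

lemma IsDensity.exists_ne_zero {C : Matrix m m ℂ} (hC : IsDensity C) : ∃ x y, C x y ≠ 0 := by
  by_contra! h
  have ht := hC.trace_eq_one
  rw [show C = 0 from Matrix.ext h, Matrix.trace_zero] at ht
  exact zero_ne_one ht

/-- A state whose kernel contains an unextendible product basis is entangled. -/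
theorem IsUPB.not_isSeparable [DecidableEq m] [DecidableEq n] {U : Set (EuclideanSpace ℂ (m × n))}
    (hU : IsUPB U)
    {ρ : Matrix (m × n) (m × n) ℂ} (hρ : ∀ u ∈ U, ρ.mulVec u = 0) : ¬ IsSeparable ρ := by
  rintro ⟨N, p, A, B, hp, hsum, hA, hB, rfl⟩
  obtain ⟨i, hi⟩ : ∃ i, p i ≠ 0 := by
    by_contra! h
    simp [h] at hsum
  have hAB : ∀ j, (A j ⊗ₖ B j).PosSemidef := fun j => (hA j).posSemidef.kronecker (hB j).posSemidef
  have hterm : ∀ j, ((p j : ℂ) • (A j ⊗ₖ B j)).PosSemidef := fun j =>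
    (hAB j).smul (Complex.zero_le_real.2 (hp j))
  -- The quadratic forms of the terms are nonnegative and sum to zero at `u`, so a term of nonzero
  -- weight kills `u`.
  have hker : ∀ u ∈ U, (A i ⊗ₖ B i).mulVec u = 0 := by
    intro u hu
    have h := congrArg (star (u : m × n → ℂ) ⬝ᵥ ·) (hρ u hu)
    simp only [Matrix.sum_mulVec, dotProduct_zero, dotProduct_sum] at h
    rw [Finset.sum_eq_zero_iff_of_nonneg fun j _ => (hterm j).dotProduct_mulVec_nonneg _] at h
    have h' := ((hterm i).dotProduct_mulVec_zero_iff _).1 (h i (Finset.mem_univ i))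
    rw [Matrix.smul_mulVec] at h'
    exact (smul_eq_zero.1 h').resolve_left (by simpa using hi)
  obtain ⟨x, y, hxy⟩ := (hA i).exists_ne_zero
  obtain ⟨z, w, hzw⟩ := (hB i).exists_ne_zero
  -- A nonzero column of `A i ⊗ₖ B i` is a product vector, and it is orthogonal to the kernel
  -- because the matrix is Hermitian.
  refine hU.unextendible (prodKet (WithLp.toLp 2 fun s => A i s y) (WithLp.toLp 2 fun s => B i s w))
    ?_ ⟨?_, _, _, rfl⟩
  · rw [Submodule.mem_orthogonal]
    intro v hv
    induction hv using Submodule.span_induction with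
    | mem u hu =>
      have h := congrArg star (congrFun (hker u hu) (y, w))
      simp only [Pi.zero_apply, star_zero, Matrix.mulVec, dotProduct, star_sum, star_mul'] at h
      rw [inner_eq_sum, ← h]
      refine Finset.sum_congr rfl fun q _ => ?_
      rw [← Matrix.conjTranspose_apply, (hAB i).isHermitian.eq]
      simp [mul_comm]
    | zero => simp
    | add x y _ _ hx hy => rw [inner_add_left, hx, hy, add_zero]
    | smul c x _ hx => rw [inner_smul_left, hx, mul_zero]
  · intro h
    have := congrFun (congrArg WithLp.ofLp h) (x, z)
    simp [hxy, hzw] at this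

/-! ### The Peres set -/

lemma isDensity_average {ι : Type*} (s : Finset ι) (hs : s.Nonempty) (ρ : ι → Matrix m m ℂ)
    (h : ∀ i ∈ s, IsDensity (ρ i)) : IsDensity ((s.card : ℂ)⁻¹ • ∑ i ∈ s, ρ i) := by
  have hc : (s.card : ℂ) ≠ 0 := by simpa [Finset.card_eq_zero] using hs.ne_empty
  refine ⟨(Matrix.posSemidef_sum s fun i hi => (h i hi).posSemidef).smul ?_, ?_⟩
  · rw [← Complex.ofReal_natCast, ← Complex.ofReal_inv, Complex.zero_le_real]
    positivity
  · rw [Matrix.trace_smul, Matrix.trace_sum, Finset.sum_congr rfl fun i hi => (h i hi).trace_eq_one]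
    simp [hc]

lemma average_mem_peresSet {ι : Type*} (s : Finset ι) (hs : s.Nonempty)
    (ρ : ι → Matrix (m × n) (m × n) ℂ) (h : ∀ i ∈ s, ρ i ∈ peresSet m n) :
    (s.card : ℂ)⁻¹ • ∑ i ∈ s, ρ i ∈ peresSet m n := by
  refine ⟨isDensity_average s hs ρ fun i hi => (h i hi).1, ?_⟩
  have : partialTranspose ((s.card : ℂ)⁻¹ • ∑ i ∈ s, ρ i) =
      (s.card : ℂ)⁻¹ • ∑ i ∈ s, partialTranspose (ρ i) := by
    rw [← partialTranspose_sum]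
    rfl
  rw [this]
  refine (Matrix.posSemidef_sum s fun i hi => (h i hi).2).smul ?_
  rw [← Complex.ofReal_natCast, ← Complex.ofReal_inv, Complex.zero_le_real]
  positivity

/-- The kernel of a proper mixture of positive semidefinite matrices lies in the kernel of each
component. -/
lemma mulVec_eq_zero_of_mixture {A B : Matrix m m ℂ} (hA : A.PosSemidef) (hB : B.PosSemidef)
    {a b : ℝ} (ha : 0 < a) (hb : 0 < b) {x : m → ℂ} (h : (a • A + b • B).mulVec x = 0) :
    A.mulVec x = 0 := by
  have hA' := hA.smul (Complex.zero_le_real.2 ha.le)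
  have hB' := hB.smul (Complex.zero_le_real.2 hb.le)
  have e : a • A + b • B = (a : ℂ) • A + (b : ℂ) • B := by
    ext i j; simp
  rw [e, Matrix.add_mulVec] at h
  have h1 := congrArg (star x ⬝ᵥ ·) h
  simp only [dotProduct_add, dotProduct_zero] at h1
  have h2 := ((add_eq_zero_iff_of_nonneg (hA'.dotProduct_mulVec_nonneg x)
    (hB'.dotProduct_mulVec_nonneg x)).1 h1).1
  have h3 := (hA'.dotProduct_mulVec_zero_iff x).1 h2
  rw [Matrix.smul_mulVec] at h3
  exact (smul_eq_zero.1 h3).resolve_left (by simpa using ha.ne')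

end General

/-! ### The cells of the tiles -/

/-- The cells of the `t`-th tile of layer `k`. -/
def InTile (d k : ℕ) (t : Fin 4) (p : Fin d × Fin d) : Prop :=
  match t with
  | 0 => (p.1 : ℕ) = lo d k ∧ lo d k ≤ p.2 ∧ (p.2 : ℕ) ≤ hi d k - 1
  | 1 => (p.1 : ℕ) = hi d k ∧ lo d k + 1 ≤ p.2 ∧ (p.2 : ℕ) ≤ hi d k
  | 2 => (p.2 : ℕ) = hi d k ∧ lo d k ≤ p.1 ∧ (p.1 : ℕ) ≤ hi d k - 1
  | 3 => (p.2 : ℕ) = lo d k ∧ lo d k + 1 ≤ p.1 ∧ (p.1 : ℕ) ≤ hi d k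

instance (d k : ℕ) (t : Fin 4) (p : Fin d × Fin d) : Decidable (InTile d k t p) :=
  match t with
  | 0 => inferInstanceAs (Decidable (_ ∧ _))
  | 1 => inferInstanceAs (Decidable (_ ∧ _))
  | 2 => inferInstanceAs (Decidable (_ ∧ _))
  | 3 => inferInstanceAs (Decidable (_ ∧ _))

/-- The cells of the square bounded by layer `k`. -/
def InSquare (d k : ℕ) (p : Fin d × Fin d) : Prop :=
  (lo d k ≤ p.1 ∧ (p.1 : ℕ) ≤ hi d k) ∧ lo d k ≤ p.2 ∧ (p.2 : ℕ) ≤ hi d k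

instance (d k : ℕ) (p : Fin d × Fin d) : Decidable (InSquare d k p) :=
  inferInstanceAs (Decidable (_ ∧ _))

/-- The coordinate which varies along the `t`-th tile of a layer. -/
def tileCoord {d : ℕ} (t : Fin 4) (p : Fin d × Fin d) : ℕ :=
  match t with
  | 0 => p.2
  | 1 => p.2
  | 2 => p.1
  | 3 => p.1

@[simp] lemma rangeKet_apply (d a b : ℕ) (f : ℕ → ℂ) (j : Fin d) :
    rangeKet d a b f j = if a ≤ (j : ℕ) ∧ (j : ℕ) ≤ b then f j else 0 := rfl

lemma ket_apply (d a : ℕ) (j : Fin d) : ket d a j = if (j : ℕ) = a then 1 else 0 := by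
  rw [ket, rangeKet_apply]
  exact if_congr (by omega) rfl rfl

lemma tileKet_apply (d k : ℕ) (f : ℕ → ℂ) (t : Fin 4) (p : Fin d × Fin d) :
    tileKet d k f t p = if InTile d k t p then f (tileCoord t p) else 0 := by
  by_cases h : InTile d k t p
  · rw [if_pos h]
    fin_cases t <;> simp only [InTile] at h <;>
      simp [tileKet, ket_apply, tileCoord, h]
  · rw [if_neg h]
    fin_cases t <;> simp only [InTile] at h <;>
      simp only [tileKet, prodKet_apply, ket_apply, rangeKet_apply, mul_ite, ite_mul] <;>
      split_ifs <;> first | (exfalso; tauto) | simp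

lemma missing_apply (d k : ℕ) (t : Fin 4) (p : Fin d × Fin d) :
    missing d k t p = if InTile d k t p then 1 else 0 :=
  tileKet_apply d k _ t p

lemma squareKet_apply (d k : ℕ) (p : Fin d × Fin d) :
    squareKet d k p = if InSquare d k p then 1 else 0 := by
  by_cases h : InSquare d k p
  · rw [if_pos h]
    simp [squareKet, h.1, h.2]
  · rw [if_neg h]
    simp only [InSquare, not_and_or] at h
    simp only [squareKet, prodKet_apply, rangeKet_apply]
    split_ifs <;> first | (exfalso; tauto) | simp

lemma stopper_apply (d : ℕ) (p : Fin d × Fin d) : stopper d p = 1 := by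
  have h1 := p.1.isLt
  have h2 := p.2.isLt
  simp only [stopper, prodKet_apply, rangeKet_apply]
  rw [if_pos (by omega), if_pos (by omega), one_mul]

/-- The larger of the two coordinate distances from the centre determines the layer. Within a layer
each tile omits one end of its side, in pinwheel fashion, so that every corner belongs to exactly
one tile. -/
lemma inTile_disjoint {d k k' : ℕ} {t t' : Fin 4} {p : Fin d × Fin d}
    (hk : k ∈ Finset.Icc 1 ((d - 1) / 2)) (hk' : k' ∈ Finset.Icc 1 ((d - 1) / 2))
    (h : InTile d k t p) (h' : InTile d k' t' p) : k = k' ∧ t = t' := by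
  rw [Finset.mem_Icc] at hk hk'
  fin_cases t <;> fin_cases t' <;> simp only [InTile, lo, hi] at h h' <;>
  first
  | (refine ⟨?_, rfl⟩; omega)
  | (exfalso; omega)

/-- A tile of layer `k'` lies inside the square of layer `k` if `k' ≤ k`, and outside it
otherwise. -/
lemma inSquare_iff_of_inTile {d k k' : ℕ} {t : Fin 4} {p : Fin d × Fin d}
    (hk : k ≤ (d - 1) / 2) (hk' : k' ∈ Finset.Icc 1 ((d - 1) / 2))
    (h : InTile d k' t p) : InSquare d k p ↔ k' ≤ k := by
  rw [Finset.mem_Icc] at hk'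
  fin_cases t <;> simp only [InTile, InSquare, lo, hi] at h ⊢ <;> omega

/-- The square bounded by layer `k` consists of the four tiles of the layer and of the square
inside it. -/
lemma squareKet_eq {d k : ℕ} (hk : k ∈ Finset.Icc 1 ((d - 1) / 2)) (p : Fin d × Fin d) :
    squareKet d k p = missing d k 0 p + missing d k 1 p + missing d k 2 p + missing d k 3 p
      + squareKet d (k - 1) p := by
  rw [Finset.mem_Icc] at hk
  simp only [missing_apply, squareKet_apply]
  split_ifs with h1 h2 h3 h4 h5 h6 <;> simp only [InTile, InSquare, lo, hi] at * <;>
    first | (exfalso; omega) | simp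

/-! ### Inner products -/

lemma inner_rangeKet {d a b a' b' : ℕ} (f g : ℕ → ℂ) (ha : a' ≤ a) (hb : b ≤ b') (hd : b < d) :
    inner ℂ (rangeKet d a' b' f) (rangeKet d a b g) = ∑ j ∈ Finset.Icc a b, star (f j) * g j := by
  rw [inner_eq_sum]
  simp only [rangeKet_apply]
  rw [Fin.sum_univ_eq_sum_range (fun j => star (if a' ≤ j ∧ j ≤ b' then f j else 0) *
    (if a ≤ j ∧ j ≤ b then g j else 0)) d, ← Finset.sum_subset (s₁ := Finset.Icc a b)]
  · refine Finset.sum_congr rfl fun j hj => ?_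
    rw [Finset.mem_Icc] at hj
    rw [if_pos (by omega), if_pos hj]
  · intro j hj
    rw [Finset.mem_Icc] at hj
    rw [Finset.mem_range]
    omega
  · intro j _ hj
    rw [Finset.mem_Icc] at hj
    rw [if_neg hj, mul_zero]

lemma inner_ket_self {d a : ℕ} (h : a < d) : inner ℂ (ket d a) (ket d a) = 1 := by
  rw [ket, inner_rangeKet _ _ le_rfl le_rfl h]
  simp

/-- The first value of the varying coordinate on the `t`-th tile of layer `k`. -/
def tileStart (d k : ℕ) (t : Fin 4) : ℕ := if t = 0 ∨ t = 2 then lo d k else lo d k + 1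

lemma inner_tileKet_self {d k : ℕ} (hk : k ∈ Finset.Icc 1 ((d - 1) / 2)) (f g : ℕ → ℂ)
    (t : Fin 4) :
    inner ℂ (tileKet d k f t) (tileKet d k g t) =
      ∑ j ∈ Finset.range (2 * k), star (f (tileStart d k t + j)) * g (tileStart d k t + j) := by
  rw [Finset.mem_Icc] at hk
  have h : ∀ a b, b + 1 - a = 2 * k → ∑ j ∈ Finset.Icc a b, star (f j) * g j =
      ∑ j ∈ Finset.range (2 * k), star (f (a + j)) * g (a + j) := by
    intro a b hab
    rw [← Finset.Ico_add_one_right_eq_Icc, Finset.sum_Ico_eq_sum_range, hab]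
  have hlo : lo d k < d := by unfold lo; omega
  have hhi : hi d k < d := by unfold hi; omega
  have h1 : hi d k - 1 + 1 - lo d k = 2 * k := by unfold lo hi; omega
  have h2 : hi d k + 1 - (lo d k + 1) = 2 * k := by unfold lo hi; omega
  fin_cases t <;> simp only [tileKet, inner_prodKet] <;>
  rw [inner_ket_self (by assumption), inner_rangeKet _ _ le_rfl le_rfl (by omega), h _ _ (by omega)]
    <;> simp [tileStart]

lemma isPrimitiveRoot_layer {k : ℕ} (hk : k ≠ 0) :
    IsPrimitiveRoot (Complex.exp (Real.pi * Complex.I / k)) (2 * k) := by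
  have h := Complex.isPrimitiveRoot_exp (2 * k) (by omega)
  convert h using 2
  have : (k : ℂ) ≠ 0 := by exact_mod_cast hk
  push_cast
  field_simp

/-- Distinct characters are orthogonal on any interval of length `2 k`. -/
lemma sum_fourier_mul {k a : ℕ} (hk : 1 ≤ k) {x y : ℕ} (hx : x < 2 * k) (hy : y < 2 * k)
    (hxy : x ≠ y) :
    ∑ j ∈ Finset.range (2 * k), star (fourier k x (a + j)) * fourier k y (a + j) = 0 := by
  set ω := Complex.exp (Real.pi * Complex.I / k) with hω
  have hprim : IsPrimitiveRoot ω (2 * k) := isPrimitiveRoot_layer (by omega)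
  have hnorm : star ω * ω = 1 := by
    have h : ‖ω‖ = 1 := hprim.norm'_eq_one (by omega)
    rw [Complex.star_def, mul_comm, Complex.mul_conj, Complex.normSq_eq_norm_sq, h]
    norm_num
  have hstar : star ω = ω⁻¹ := eq_inv_of_mul_eq_one_left hnorm
  have h0 : ω ≠ 0 := Complex.exp_ne_zero _
  -- The terms form a geometric progression with ratio `ζ`, a `2 k`-th root of unity other than 1.
  set ζ := (ω⁻¹) ^ x * ω ^ y with hζ
  have hζ1 : ζ ≠ 1 := by
    intro h
    refine hxy (hprim.pow_inj hx hy ?_)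
    rw [hζ, inv_pow, inv_mul_eq_one₀ (pow_ne_zero _ h0)] at h
    exact h
  have hζ2 : ζ ^ (2 * k) = 1 := by
    rw [hζ, mul_pow, ← pow_mul, ← pow_mul, mul_comm x, mul_comm y, pow_mul, pow_mul ω, inv_pow ω,
      hprim.pow_eq_one]
    simp
  have hterm : ∀ j, star (fourier k x (a + j)) * fourier k y (a + j) = ζ ^ a * ζ ^ j := by
    intro j
    rw [fourier, fourier, ← hω, star_pow, hstar, ← pow_add, hζ, mul_pow, ← pow_mul, ← pow_mul,
      mul_comm x, mul_comm y]
  simp only [hterm]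
  rw [← Finset.mul_sum, geom_sum_eq hζ1, hζ2, sub_self, zero_div, mul_zero]

lemma inner_tileKet_of_ne {d k k' : ℕ} {t t' : Fin 4} (f g : ℕ → ℂ)
    (hk : k ∈ Finset.Icc 1 ((d - 1) / 2)) (hk' : k' ∈ Finset.Icc 1 ((d - 1) / 2))
    (h : ¬ (k = k' ∧ t = t')) : inner ℂ (tileKet d k f t) (tileKet d k' g t') = 0 := by
  rw [inner_eq_sum]
  refine Finset.sum_eq_zero fun p _ => ?_
  rw [tileKet_apply, tileKet_apply]
  split_ifs with h1 h2
  · exact absurd (inTile_disjoint hk hk' h1 h2) h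
  all_goals simp

lemma fourier_zero (k : ℕ) : fourier k 0 = fun _ => 1 := by
  ext j
  simp [fourier]

lemma inner_missing_self {d k : ℕ} (hk : k ∈ Finset.Icc 1 ((d - 1) / 2)) (t : Fin 4) :
    inner ℂ (missing d k t) (missing d k t) = 2 * (k : ℂ) := by
  rw [missing, inner_tileKet_self hk]
  simp

lemma inner_tileKet_fourier_self {d k : ℕ} (hk : k ∈ Finset.Icc 1 ((d - 1) / 2)) (x : ℕ)
    (t : Fin 4) :
    inner ℂ (tileKet d k (fourier k x) t) (tileKet d k (fourier k x) t) = 2 * (k : ℂ) := by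
  rw [inner_tileKet_self hk]
  have hk0 : k ≠ 0 := by rw [Finset.mem_Icc] at hk; omega
  have h : ∀ j, star (fourier k x j) * fourier k x j = 1 := by
    intro j
    have h : ‖fourier k x j‖ = 1 := by
      rw [fourier, norm_pow, (isPrimitiveRoot_layer hk0).norm'_eq_one (by omega), one_pow]
    rw [Complex.star_def, mul_comm, Complex.mul_conj, Complex.normSq_eq_norm_sq, h]
    norm_num
  simp only [h, Finset.sum_const, Finset.card_range, nsmul_eq_mul]
  push_cast
  ring

/-- A nontrivial character on a tile is orthogonal to all vectors which are constant there. -/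
lemma inner_tileKet_fourier_eq_zero {d k x : ℕ} (hk : k ∈ Finset.Icc 1 ((d - 1) / 2))
    (hx : x ∈ Finset.Icc 1 (2 * k - 1)) (t : Fin 4) {v : EuclideanSpace ℂ (Fin d × Fin d)} {c : ℂ}
    (hv : ∀ p, InTile d k t p → v p = c) :
    inner ℂ (tileKet d k (fourier k x) t) v = 0 := by
  have h : inner ℂ (tileKet d k (fourier k x) t) v =
      inner ℂ (tileKet d k (fourier k x) t) (missing d k t) * c := by
    simp only [inner_eq_sum, Finset.sum_mul]
    refine Finset.sum_congr rfl fun p _ => ?_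
    rw [tileKet_apply, missing_apply]
    split_ifs with hp
    · rw [hv p hp, mul_one]
    · simp
  rw [Finset.mem_Icc] at hx
  rw [h, missing, ← fourier_zero k, inner_tileKet_self hk,
    sum_fourier_mul (Finset.mem_Icc.1 hk).1 (by omega) (by omega) (by omega), zero_mul]

/-! ### The entangled vectors -/

lemma squareKet_eq_add {d k : ℕ} (hk : k ∈ Finset.Icc 1 ((d - 1) / 2)) :
    squareKet d k = missing d k 0 + missing d k 1 + missing d k 2 + missing d k 3
      + squareKet d (k - 1) := by
  ext p
  exact squareKet_eq hk p

lemma inner_squareKet_self {d k : ℕ} (hd : 0 < d) (hk : k ≤ (d - 1) / 2) :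
    inner ℂ (squareKet d k) (squareKet d k) = (2 * (k : ℂ) + 1) ^ 2 := by
  have h : hi d k < d := by unfold hi; omega
  have h' : hi d k + 1 - lo d k = 2 * k + 1 := by unfold lo hi; omega
  rw [squareKet, inner_prodKet, inner_rangeKet _ _ le_rfl le_rfl h]
  simp only [star_one, mul_one, Finset.sum_const, Nat.card_Icc, h', nsmul_eq_mul]
  push_cast
  ring

lemma inner_squareKet_pred_self {d k : ℕ} (hd : 0 < d) (hk : k ∈ Finset.Icc 1 ((d - 1) / 2)) :
    inner ℂ (squareKet d (k - 1)) (squareKet d (k - 1)) = (2 * (k : ℂ) - 1) ^ 2 := by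
  rw [Finset.mem_Icc] at hk
  rw [inner_squareKet_self hd (by omega), Nat.cast_sub hk.1]
  push_cast
  ring

lemma inner_missing {d k : ℕ} (hk : k ∈ Finset.Icc 1 ((d - 1) / 2)) (t t' : Fin 4) :
    inner ℂ (missing d k t) (missing d k t') = if t = t' then 2 * (k : ℂ) else 0 := by
  split_ifs with h
  · rw [h, inner_missing_self hk]
  · exact inner_tileKet_of_ne _ _ hk hk fun h' => h h'.2

lemma inner_missing_squareKet {d k : ℕ} (hk : k ∈ Finset.Icc 1 ((d - 1) / 2)) (t : Fin 4) :
    inner ℂ (missing d k t) (squareKet d (k - 1)) = 0 := by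
  rw [inner_eq_sum]
  refine Finset.sum_eq_zero fun p _ => ?_
  rw [missing_apply, squareKet_apply]
  by_cases h : InTile d k t p
  · have hk' := Finset.mem_Icc.1 hk
    rw [if_neg (c := InSquare _ _ _), mul_zero]
    rw [inSquare_iff_of_inTile (by omega) hk h]
    omega
  · rw [if_neg h, star_zero, zero_mul]

lemma inner_squareKet_missing {d k : ℕ} (hk : k ∈ Finset.Icc 1 ((d - 1) / 2)) (t : Fin 4) :
    inner ℂ (squareKet d (k - 1)) (missing d k t) = 0 :=
  inner_eq_zero_symm.1 (inner_missing_squareKet hk t)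

-- The sign patterns on the tiles, including the all-plus pattern of the last vector, are the rows
-- of a 4 × 4 Hadamard matrix, and the inner square is disjoint from the tiles.
set_option linter.unusedSimpArgs false in
lemma entKet_orthogonal {d k : ℕ} (hk : k ∈ Finset.Icc 1 ((d - 1) / 2)) {i j : Fin 4}
    (hij : i ≠ j) : inner ℂ (entKet d k i) (entKet d k j) = 0 := by
  fin_cases i <;> fin_cases j <;> first | (exact absurd rfl hij) | skip
  all_goals
    simp [-inner_self_eq_norm_sq_to_K, entKet, inner_add_left, inner_add_right, inner_sub_left, inner_sub_right,
      inner_smul_left, inner_smul_right, inner_missing hk, inner_missing_squareKet hk,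
      inner_squareKet_missing hk]

-- For the last vector the value factors because `(2k - 1)^2 + 8k = (2k + 1)^2`: the inner square
-- and the boundary fill the square of layer `k`.
set_option linter.unusedSimpArgs false in
lemma inner_entKet_self {d k : ℕ} (hd : 0 < d) (hk : k ∈ Finset.Icc 1 ((d - 1) / 2)) (i : Fin 4) :
    inner ℂ (entKet d k i) (entKet d k i) =
      if i = 3 then 8 * (k : ℂ) * (2 * k - 1) ^ 2 * (2 * k + 1) ^ 2 else 8 * (k : ℂ) := by
  fin_cases i <;>
    simp [-inner_self_eq_norm_sq_to_K, entKet, inner_add_left, inner_add_right, inner_sub_left, inner_sub_right,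
      inner_smul_left, inner_smul_right, inner_missing hk, inner_missing_squareKet hk,
      inner_squareKet_missing hk, inner_squareKet_pred_self hd hk] <;> ring

lemma two_mul_sub_one_ne_zero (k : ℕ) : (2 * (k : ℂ) - 1) ≠ 0 := by
  intro h
  have h' : ((2 * k : ℤ) : ℂ) = ((1 : ℤ) : ℂ) := by push_cast; linear_combination h
  have := Int.cast_injective h'
  omega

lemma two_mul_add_one_ne_zero (k : ℕ) : (2 * (k : ℂ) + 1) ≠ 0 := by
  exact_mod_cast Nat.succ_ne_zero (2 * k)

lemma entKet_ne_zero {d k : ℕ} (hd : 0 < d) (hk : k ∈ Finset.Icc 1 ((d - 1) / 2)) (i : Fin 4) :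
    entKet d k i ≠ 0 := by
  have hk0 : (k : ℂ) ≠ 0 := by
    rw [Finset.mem_Icc] at hk
    exact_mod_cast (by omega : k ≠ 0)
  rw [← inner_self_ne_zero (𝕜 := ℂ), inner_entKet_self hd hk]
  have h1 := two_mul_sub_one_ne_zero k
  have h2 := two_mul_add_one_ne_zero k
  split_ifs <;> positivity

lemma entKet_apply_of_not_inSquare {d k : ℕ} (hk : k ∈ Finset.Icc 1 ((d - 1) / 2)) (i : Fin 4)
    {p : Fin d × Fin d} (hp : ¬ InSquare d k p) : entKet d k i p = 0 := by
  have hk' := Finset.mem_Icc.1 hk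
  have h1 : ∀ t, missing d k t p = 0 := by
    intro t
    rw [missing_apply, if_neg]
    intro h
    exact hp ((inSquare_iff_of_inTile hk'.2 hk h).2 le_rfl)
  have h2 : squareKet d (k - 1) p = 0 := by
    rw [squareKet_apply, if_neg]
    intro h
    apply hp
    simp only [InSquare, lo, hi] at h ⊢
    omega
  fin_cases i <;> simp [entKet, h1, h2]

-- Three of the sign patterns sum to zero over tiles of equal size. In the last vector the `8k`
-- boundary cells of weight `(2k - 1)^2` balance the `(2k - 1)^2` inner cells of weight `-8k`.
set_option linter.unusedSimpArgs false in
lemma inner_squareKet_entKet {d k : ℕ} (hd : 0 < d) (hk : k ∈ Finset.Icc 1 ((d - 1) / 2))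
    (i : Fin 4) : inner ℂ (squareKet d k) (entKet d k i) = 0 := by
  rw [squareKet_eq_add hk]
  fin_cases i <;>
    simp [-inner_self_eq_norm_sq_to_K, entKet, inner_add_left, inner_add_right, inner_sub_right, inner_smul_right,
      inner_missing hk, inner_missing_squareKet hk,
      inner_squareKet_missing hk, inner_squareKet_pred_self hd hk]
  ring

/-- Only the values of `v` on the support matter. This serves both the stopper and the entangled
vectors of outer layers. -/
lemma inner_entKet_of_const {d k : ℕ} (hd : 0 < d) (hk : k ∈ Finset.Icc 1 ((d - 1) / 2))
    (i : Fin 4) {v : EuclideanSpace ℂ (Fin d × Fin d)} {c : ℂ}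
    (hv : ∀ p, InSquare d k p → v p = c) : inner ℂ v (entKet d k i) = 0 := by
  have h : inner ℂ v (entKet d k i) = star c * inner ℂ (squareKet d k) (entKet d k i) := by
    simp only [inner_eq_sum, Finset.mul_sum]
    refine Finset.sum_congr rfl fun p _ => ?_
    rw [squareKet_apply]
    by_cases hp : InSquare d k p
    · rw [if_pos hp, hv p hp, star_one, one_mul]
    · rw [entKet_apply_of_not_inSquare hk i hp]
      simp
  rw [h, inner_squareKet_entKet hd hk, mul_zero]

/-- The entangled vectors of layer `k` are constant on every tile of every layer. -/
lemma entKet_const_on_tile {d k k' : ℕ} (hk : k ∈ Finset.Icc 1 ((d - 1) / 2))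
    (hk' : k' ∈ Finset.Icc 1 ((d - 1) / 2)) (i t : Fin 4) :
    ∃ c, ∀ p, InTile d k' t p → entKet d k i p = c := by
  have h1 : ∀ s, ∀ p, InTile d k' t p → missing d k s p = if k' = k ∧ t = s then 1 else 0 := by
    intro s p hp
    rw [missing_apply]
    refine if_congr ⟨fun h => inTile_disjoint hk' hk hp h, ?_⟩ rfl rfl
    rintro ⟨rfl, rfl⟩
    exact hp
  have h2 : ∀ p, InTile d k' t p → squareKet d (k - 1) p = if k' ≤ k - 1 then 1 else 0 := by
    intro p hp
    have := Finset.mem_Icc.1 hk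
    rw [squareKet_apply]
    exact if_congr (inSquare_iff_of_inTile (by omega) hk' hp) rfl rfl
  by_cases hne : ∃ p, InTile d k' t p
  · obtain ⟨q, hq⟩ := hne
    refine ⟨entKet d k i q, fun p hp => ?_⟩
    fin_cases i <;> simp [entKet, h1 _ p hp, h1 _ q hq, h2 p hp, h2 q hq]
  · exact ⟨0, fun p hp => absurd ⟨p, hp⟩ hne⟩

lemma entKet_const_on_square {d k k' : ℕ} (hkk' : k < k')
    (hk' : k' ∈ Finset.Icc 1 ((d - 1) / 2)) (i : Fin 4) :
    ∃ c, ∀ p, InSquare d k p → entKet d k' i p = c := by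
  have hk := Finset.mem_Icc.1 hk'
  have h1 : ∀ s, ∀ p, InSquare d k p → missing d k' s p = 0 := by
    intro s p hp
    rw [missing_apply, if_neg]
    intro h
    have := (inSquare_iff_of_inTile (k := k) (by omega) hk' h).1 hp
    omega
  have h2 : ∀ p, InSquare d k p → squareKet d (k' - 1) p = 1 := by
    intro p hp
    rw [squareKet_apply, if_pos]
    simp only [InSquare, lo, hi] at hp ⊢
    omega
  refine ⟨entKet d k' i (⟨(d - 1) / 2, by omega⟩, ⟨(d - 1) / 2, by omega⟩), fun p hp => ?_⟩
  have hq : InSquare d k (⟨(d - 1) / 2, by omega⟩, ⟨(d - 1) / 2, by omega⟩) := by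
    simp only [InSquare, lo, hi]
    omega
  fin_cases i <;> simp [entKet, h1 _ p hp, h1 _ _ hq, h2 p hp, h2 _ hq]

lemma entKet_orthogonal_of_ne {d k k' : ℕ} (hd : 0 < d) (hk : k ∈ Finset.Icc 1 ((d - 1) / 2))
    (hk' : k' ∈ Finset.Icc 1 ((d - 1) / 2)) (h : k ≠ k') (i j : Fin 4) :
    inner ℂ (entKet d k i) (entKet d k' j) = 0 := by
  rcases lt_or_gt_of_ne h with h | h
  · obtain ⟨c, hc⟩ := entKet_const_on_square h hk' j
    exact inner_eq_zero_symm.1 (inner_entKet_of_const hd hk i hc)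
  · obtain ⟨c, hc⟩ := entKet_const_on_square h hk i
    exact inner_entKet_of_const hd hk' j hc

lemma inner_entKet_tilesUPB {d k : ℕ} (hd : 0 < d)
    (hk : k ∈ Finset.Icc 1 ((d - 1) / 2)) (i : Fin 4) {u : EuclideanSpace ℂ (Fin d × Fin d)}
    (hu : u ∈ tilesUPB d) : inner ℂ u (entKet d k i) = 0 := by
  rcases hu with rfl | ⟨k', hk', x, hx, t, rfl⟩
  · exact inner_entKet_of_const hd hk i (c := 1) fun p _ => stopper_apply d p
  · obtain ⟨c, hc⟩ := entKet_const_on_tile hk hk' i t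
    exact inner_tileKet_fourier_eq_zero hk' hx t hc

/-! ### The unextendible product basis as an indexed family -/

/-- The index set of the members of the basis other than the stopper. -/
def tileIndex (d : ℕ) : Finset ((Σ _ : ℕ, ℕ) × Fin 4) :=
  ((Finset.Icc 1 ((d - 1) / 2)).sigma fun k => Finset.Icc 1 (2 * k - 1)) ×ˢ Finset.univ

lemma card_tileIndex (d : ℕ) : (tileIndex d).card = 4 * ((d - 1) / 2) ^ 2 := by
  have h : ∀ n : ℕ, ∑ k ∈ Finset.Icc 1 n, (2 * k - 1) = n ^ 2 := by
    intro n
    induction n with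
    | zero => rfl
    | succ n ih =>
      rw [Finset.sum_Icc_succ_top (by omega), ih]
      have : 2 * (n + 1) - 1 = 2 * n + 1 := by omega
      rw [this]
      ring
  rw [tileIndex, Finset.card_product, Finset.card_sigma]
  simp only [Nat.card_Icc, Nat.add_sub_cancel, h, Finset.card_univ, Fintype.card_fin]
  ring

/-- The members of the Tiles basis, the stopper being attached to `none`. -/
def tilesFamily (d : ℕ) : Option (tileIndex d) → EuclideanSpace ℂ (Fin d × Fin d)
  | none => stopper d
  | some x => tileKet d x.1.1.1 (fourier x.1.1.1 x.1.1.2) x.1.2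

lemma mem_tileIndex {d : ℕ} {x : (Σ _ : ℕ, ℕ) × Fin 4} : x ∈ tileIndex d ↔
    x.1.1 ∈ Finset.Icc 1 ((d - 1) / 2) ∧ x.1.2 ∈ Finset.Icc 1 (2 * x.1.1 - 1) := by
  simp [tileIndex]

lemma range_tilesFamily (d : ℕ) : Set.range (tilesFamily d) = tilesUPB d := by
  ext v
  constructor
  · rintro ⟨x, rfl⟩
    match x with
    | none => exact Or.inl rfl
    | some ⟨⟨⟨k, k'⟩, t⟩, hx⟩ =>
      rw [mem_tileIndex] at hx
      exact Or.inr ⟨k, hx.1, k', hx.2, t, rfl⟩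
  · rintro (rfl | ⟨k, hk, k', hk', t, rfl⟩)
    · exact ⟨none, rfl⟩
    · exact ⟨some ⟨⟨⟨k, k'⟩, t⟩, mem_tileIndex.2 ⟨hk, hk'⟩⟩, rfl⟩

lemma tilesFamily_ne_zero {d : ℕ} (hd : 0 < d) (x : Option (tileIndex d)) :
    tilesFamily d x ≠ 0 := by
  match x with
  | none =>
    intro h
    have := congrFun (congrArg WithLp.ofLp h) (⟨0, hd⟩, ⟨0, hd⟩)
    rw [tilesFamily, stopper_apply] at this
    exact one_ne_zero this
  | some ⟨⟨⟨k, k'⟩, t⟩, hx⟩ =>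
    rw [mem_tileIndex] at hx
    rw [← inner_self_ne_zero (𝕜 := ℂ)]
    refine (inner_tileKet_fourier_self hx.1 k' t).trans_ne ?_
    have := (Finset.mem_Icc.1 hx.1).1
    simp only at this
    exact_mod_cast (by omega : 2 * k ≠ 0)

lemma tilesFamily_orthogonal (d : ℕ) :
    Pairwise fun x y => inner ℂ (tilesFamily d x) (tilesFamily d y) = 0 := by
  have key : ∀ x : tileIndex d, inner ℂ (tilesFamily d (some x)) (stopper d) = 0 := by
    rintro ⟨⟨⟨k, k'⟩, t⟩, hx⟩
    rw [mem_tileIndex] at hx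
    exact inner_tileKet_fourier_eq_zero hx.1 hx.2 t (c := 1) fun p _ => stopper_apply d p
  intro x y hxy
  match x, y with
  | none, none => exact absurd rfl hxy
  | none, some y => exact inner_eq_zero_symm.1 (key y)
  | some x, none => exact key x
  | some ⟨⟨⟨k, k'⟩, t⟩, hx⟩, some ⟨⟨⟨l, l'⟩, s⟩, hy⟩ =>
    rw [mem_tileIndex] at hx hy
    by_cases h : k = l ∧ t = s
    · obtain ⟨rfl, rfl⟩ := h
      have hne : k' ≠ l' := by
        rintro rfl
        exact hxy rfl
      refine (inner_tileKet_self hx.1 _ _ t).trans ?_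
      simp only at hx hy
      simp only [Finset.mem_Icc] at hx hy
      exact sum_fourier_mul (x := k') (y := l') hx.1.1 (by omega) (by omega) hne
    · exact inner_tileKet_of_ne _ _ hx.1 hy.1 h

lemma tilesFamily_injective {d : ℕ} (hd : 0 < d) : Function.Injective (tilesFamily d) := by
  intro x y hxy
  by_contra hne
  have h := tilesFamily_orthogonal d hne
  simp only [hxy] at h
  exact tilesFamily_ne_zero hd y (inner_self_eq_zero.1 h)

lemma card_tilesFamily {d : ℕ} (hodd : Odd d) :
    Fintype.card (Option (tileIndex d)) = (d - 1) ^ 2 + 1 := by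
  rw [Fintype.card_option, Fintype.card_coe, card_tileIndex]
  obtain ⟨n, rfl⟩ := hodd
  have h1 : (2 * n + 1 - 1) / 2 = n := by omega
  have h2 : 2 * n + 1 - 1 = 2 * n := by omega
  rw [h1, h2]
  ring

lemma ncard_tilesUPB {d : ℕ} (hodd : Odd d) : (tilesUPB d).ncard = (d - 1) ^ 2 + 1 := by
  rw [← range_tilesFamily, ← Set.image_univ, Set.ncard_image_of_injective _
    (tilesFamily_injective hodd.pos), Set.ncard_univ, Nat.card_eq_fintype_card,
    card_tilesFamily hodd]

/-! ### Dimension and orthogonal basis of the entangled subspace. -/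

lemma finrank_span_tilesUPB {d : ℕ} (hodd : Odd d) :
    Module.finrank ℂ (Submodule.span ℂ (tilesUPB d)) = (d - 1) ^ 2 + 1 := by
  rw [← range_tilesFamily, finrank_span_eq_card (linearIndependent_of_ne_zero_of_inner_eq_zero
    (tilesFamily_ne_zero hodd.pos) (tilesFamily_orthogonal d)), card_tilesFamily hodd]

lemma finrank_entangledSubspace {d : ℕ} (hodd : Odd d) :
    Module.finrank ℂ (entangledSubspace d) = 2 * (d - 1) := by
  have h := Submodule.finrank_add_finrank_orthogonal (Submodule.span ℂ (tilesUPB d))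
  rw [finrank_span_tilesUPB hodd, finrank_euclideanSpace, Fintype.card_prod, Fintype.card_fin] at h
  rw [entangledSubspace]
  obtain ⟨n, rfl⟩ := hodd
  have h2 : 2 * n + 1 - 1 = 2 * n := by omega
  rw [h2] at h ⊢
  nlinarith

/-- The entangled vectors of all layers. -/
def entFamily (d : ℕ) (x : Finset.Icc 1 ((d - 1) / 2) × Fin 4) :
    EuclideanSpace ℂ (Fin d × Fin d) := entKet d x.1 x.2

lemma entFamily_orthogonal {d : ℕ} (hd : 0 < d) :
    Pairwise fun x y => inner ℂ (entFamily d x) (entFamily d y) = 0 := by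
  rintro ⟨k, i⟩ ⟨l, j⟩ h
  by_cases hkl : k = l
  · subst hkl
    refine entKet_orthogonal k.2 ?_
    rintro rfl
    exact h rfl
  · exact entKet_orthogonal_of_ne hd k.2 l.2 (fun h => hkl (Subtype.ext h)) i j

lemma entFamily_ne_zero {d : ℕ} (hd : 0 < d) (x : Finset.Icc 1 ((d - 1) / 2) × Fin 4) :
    entFamily d x ≠ 0 :=
  entKet_ne_zero hd x.1.2 x.2

lemma card_entFamily {d : ℕ} (hodd : Odd d) :
    Fintype.card (Finset.Icc 1 ((d - 1) / 2) × Fin 4) = 2 * (d - 1) := by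
  obtain ⟨n, rfl⟩ := hodd
  simp
  omega

/-- The inclusion is orthogonality to the Tiles basis; equality follows by counting dimensions. -/
lemma span_entFamily {d : ℕ} (hodd : Odd d) :
    Submodule.span ℂ (Set.range (entFamily d)) = entangledSubspace d := by
  refine Submodule.eq_of_le_of_finrank_eq ?_ ?_
  · rw [Submodule.span_le]
    rintro _ ⟨⟨k, i⟩, rfl⟩
    rw [SetLike.mem_coe, entangledSubspace, Submodule.mem_orthogonal]
    intro v hv
    induction hv using Submodule.span_induction with
    | mem u hu => exact inner_entKet_tilesUPB hodd.pos k.2 i hu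
    | zero => simp
    | add x y _ _ hx hy => rw [inner_add_left, hx, hy, add_zero]
    | smul c x _ hx => rw [inner_smul_left, hx, mul_zero]
  · rw [finrank_span_eq_card (linearIndependent_of_ne_zero_of_inner_eq_zero
      (entFamily_ne_zero hodd.pos) (entFamily_orthogonal hodd.pos)),
      finrank_entangledSubspace hodd, card_entFamily hodd]

/-- Vectors orthogonal to the Tiles basis are constant on every tile. -/
lemma const_on_tile_of_mem {d k : ℕ} (hodd : Odd d) {v : EuclideanSpace ℂ (Fin d × Fin d)}
    (hv : v ∈ entangledSubspace d) (hk : k ∈ Finset.Icc 1 ((d - 1) / 2)) {t : Fin 4}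
    {p q : Fin d × Fin d} (hp : InTile d k t p) (hq : InTile d k t q) : v p = v q := by
  -- Constancy is checked on the spanning family, which avoids inverting the Fourier transform on
  -- the tile.
  rw [← span_entFamily hodd] at hv
  induction hv using Submodule.span_induction with
  | mem u hu =>
    obtain ⟨x, rfl⟩ := hu
    obtain ⟨c, hc⟩ := entKet_const_on_tile x.1.2 hk x.2 t
    exact (hc p hp).trans (hc q hq).symm
  | zero => rfl
  | add x y _ _ hx hy => rw [PiLp.add_apply, PiLp.add_apply, hx, hy]
  | smul c x _ hx => rw [PiLp.smul_apply, PiLp.smul_apply, hx]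

lemma sum_eq_zero_of_mem {d : ℕ} {v : EuclideanSpace ℂ (Fin d × Fin d)}
    (hv : v ∈ entangledSubspace d) : ∑ p, v p = 0 := by
  have h := (Submodule.mem_orthogonal _ _).1 hv (stopper d) (Submodule.subset_span (Or.inl rfl))
  rw [inner_eq_sum] at h
  simpa [stopper_apply] using h

/-! ### Unextendibility -/

/-- The sum is `c` times the number of nonzero entries. A product array with two such factors
therefore violates orthogonality to the stopper. -/
lemma sum_ne_zero_of_flat {ι : Type*} [Fintype ι] {a : ι → ℂ} {c : ℂ}
    (h : ∀ i, a i = 0 ∨ a i = c) {i₀ : ι} (h₀ : a i₀ ≠ 0) : ∑ i, a i ≠ 0 := by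
  classical
  have hc : c ≠ 0 := by
    rcases h i₀ with h | h
    · exact absurd h h₀
    · exact h ▸ h₀
  have e : ∀ i, a i = if a i ≠ 0 then c else 0 := by
    intro i
    split_ifs with hi
    · exact (h i).resolve_left hi
    · exact not_not.1 hi
  rw [Finset.sum_congr rfl fun i _ => e i, ← Finset.sum_filter, Finset.sum_const, nsmul_eq_mul]
  refine mul_ne_zero ?_ hc
  rw [Nat.cast_ne_zero, Finset.card_ne_zero]
  exact ⟨i₀, by simpa using h₀⟩

/-- A product array which is supported on a square and constant on the four tiles of its boundary,
and whose entries sum to zero, vanishes on the boundary. -/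
lemma boundary_eq_zero {d : ℕ} {a b : Fin d → ℂ} {l h : Fin d} (hlh : (l : ℕ) + 2 ≤ h)
    (ha : ∀ i : Fin d, ¬ ((l : ℕ) ≤ i ∧ (i : ℕ) ≤ h) → a i = 0)
    (hb : ∀ i : Fin d, ¬ ((l : ℕ) ≤ i ∧ (i : ℕ) ≤ h) → b i = 0)
    (h0 : ∀ j : Fin d, (l : ℕ) ≤ j → (j : ℕ) ≤ h - 1 → a l * b j = a l * b l)
    (h1 : ∀ j : Fin d, (l : ℕ) + 1 ≤ j → (j : ℕ) ≤ h → a h * b j = a h * b h)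
    (h2 : ∀ i : Fin d, (l : ℕ) ≤ i → (i : ℕ) ≤ h - 1 → a i * b h = a l * b h)
    (h3 : ∀ i : Fin d, (l : ℕ) + 1 ≤ i → (i : ℕ) ≤ h → a i * b l = a h * b l)
    (hsum : (∑ i, a i) * ∑ j, b j = 0) {i₀ j₀ : Fin d} (hne : a i₀ * b j₀ ≠ 0) :
    a l = 0 ∧ a h = 0 ∧ b l = 0 ∧ b h = 0 := by
  have flat : ∀ {c e : ℂ}, (∀ i, a i = 0 ∨ a i = c) → (∀ j, b j = 0 ∨ b j = e) → False := by
    intro c e hc he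
    exact mul_ne_zero (sum_ne_zero_of_flat hc (left_ne_zero_of_mul hne))
      (sum_ne_zero_of_flat he (right_ne_zero_of_mul hne)) hsum
  have pos : ∀ i : Fin d, i = l ∨ i = h ∨ ((l : ℕ) + 1 ≤ i ∧ (i : ℕ) ≤ h - 1) ∨
      ¬ ((l : ℕ) ≤ i ∧ (i : ℕ) ≤ h) := by
    intro i
    simp only [Fin.ext_iff]
    omega
  -- An index strictly between the corners lies in the range of all four tiles and so links
  -- conditions on opposite sides.
  let m : Fin d := ⟨l + 1, by have := h.isLt; omega⟩
  have hm1 : (l : ℕ) + 1 ≤ m := le_rfl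
  have hm2 : (m : ℕ) ≤ h - 1 := by simp only [m]; omega
  -- Unless all four end values vanish, the tile equations make both factors flat, or one factor
  -- zero; either is excluded.
  by_cases hal : a l = 0
  · by_cases hbh : b h = 0
    · by_cases hah : a h = 0
      · refine ⟨hal, hah, ?_, hbh⟩
        by_contra hbl
        apply left_ne_zero_of_mul hne
        rcases pos i₀ with rfl | rfl | hi | hi
        · exact hal
        · exact hah
        · have := h3 i₀ hi.1 (by omega)
          rw [hah, zero_mul] at this
          exact (mul_eq_zero.1 this).resolve_right hbl
        · exact ha _ hi
      · exfalso
        have hb' : ∀ j : Fin d, (l : ℕ) + 1 ≤ j → (j : ℕ) ≤ h → b j = 0 := by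
          intro j hj hj'
          have := h1 j hj hj'
          rw [hbh, mul_zero] at this
          exact (mul_eq_zero.1 this).resolve_left hah
        have hbl : b l ≠ 0 := by
          intro hbl
          apply right_ne_zero_of_mul hne
          rcases pos j₀ with rfl | rfl | hj | hj
          · exact hbl
          · exact hbh
          · exact hb' _ hj.1 (by omega)
          · exact hb _ hj
        refine flat (c := a h) (e := b l) (fun i => ?_) fun j => ?_
        · rcases pos i with rfl | rfl | hi | hi
          · exact Or.inl hal
          · exact Or.inr rfl
          · exact Or.inr (mul_right_cancel₀ hbl (h3 i hi.1 (by omega)))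
          · exact Or.inl (ha _ hi)
        · rcases pos j with rfl | rfl | hj | hj
          · exact Or.inr rfl
          · exact Or.inl hbh
          · exact Or.inl (hb' _ hj.1 (by omega))
          · exact Or.inl (hb _ hj)
    · exfalso
      have ha' : ∀ i : Fin d, (l : ℕ) ≤ i → (i : ℕ) ≤ h - 1 → a i = 0 := by
        intro i hi hi'
        have := h2 i hi hi'
        rw [hal, zero_mul] at this
        exact (mul_eq_zero.1 this).resolve_right hbh
      have hah : a h ≠ 0 := by
        intro hah
        apply left_ne_zero_of_mul hne
        rcases pos i₀ with rfl | rfl | hi | hi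
        · exact hal
        · exact hah
        · exact ha' _ (by omega) hi.2
        · exact ha _ hi
      have hbl : b l = 0 := by
        have := h3 m hm1 (by omega)
        rw [ha' m (by omega) hm2, zero_mul] at this
        exact (mul_eq_zero.1 this.symm).resolve_left hah
      refine flat (c := a h) (e := b h) (fun i => ?_) fun j => ?_
      · rcases pos i with rfl | rfl | hi | hi
        · exact Or.inl hal
        · exact Or.inr rfl
        · exact Or.inl (ha' i (by omega) hi.2)
        · exact Or.inl (ha _ hi)
      · rcases pos j with rfl | rfl | hj | hj
        · exact Or.inl hbl
        · exact Or.inr rfl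
        · exact Or.inr (mul_left_cancel₀ hah (h1 j hj.1 (by omega)))
        · exact Or.inl (hb _ hj)
  · exfalso
    have hb' : ∀ j : Fin d, (l : ℕ) ≤ j → (j : ℕ) ≤ h - 1 → b j = b l := fun j hj hj' =>
      mul_left_cancel₀ hal (h0 j hj hj')
    by_cases hbl : b l = 0
    · have hbh : b h ≠ 0 := by
        intro hbh
        apply right_ne_zero_of_mul hne
        rcases pos j₀ with rfl | rfl | hj | hj
        · exact hbl
        · exact hbh
        · exact (hb' _ (by omega) hj.2).trans hbl
        · exact hb _ hj
      have hah : a h = 0 := by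
        have := h1 m hm1 (by omega)
        rw [hb' m (by omega) hm2, hbl, mul_zero] at this
        exact (mul_eq_zero.1 this.symm).resolve_right hbh
      refine flat (c := a l) (e := b h) (fun i => ?_) fun j => ?_
      · rcases pos i with rfl | rfl | hi | hi
        · exact Or.inr rfl
        · exact Or.inl hah
        · exact Or.inr (mul_right_cancel₀ hbh (h2 i (by omega) hi.2))
        · exact Or.inl (ha _ hi)
      · rcases pos j with rfl | rfl | hj | hj
        · exact Or.inl hbl
        · exact Or.inr rfl
        · exact Or.inl ((hb' j (by omega) hj.2).trans hbl)
        · exact Or.inl (hb _ hj)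
    · have ha' : ∀ i : Fin d, (l : ℕ) + 1 ≤ i → (i : ℕ) ≤ h → a i = a h := fun i hi hi' =>
        mul_right_cancel₀ hbl (h3 i hi hi')
      by_cases hah : a h = 0
      · have hbh : b h = 0 := by
          have := h2 m (by omega) hm2
          rw [ha' m hm1 (by omega), hah, zero_mul] at this
          exact (mul_eq_zero.1 this.symm).resolve_left hal
        refine flat (c := a l) (e := b l) (fun i => ?_) fun j => ?_
        · rcases pos i with rfl | rfl | hi | hi
          · exact Or.inr rfl
          · exact Or.inl hah
          · exact Or.inl ((ha' i hi.1 (by omega)).trans hah)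
          · exact Or.inl (ha _ hi)
        · rcases pos j with rfl | rfl | hj | hj
          · exact Or.inr rfl
          · exact Or.inl hbh
          · exact Or.inr (hb' j (by omega) hj.2)
          · exact Or.inl (hb _ hj)
      · have hbh : b h = b l := by
          rw [← hb' m (by omega) hm2]
          exact (mul_left_cancel₀ hah (h1 m hm1 (by omega))).symm
        have hah' : a h = a l := by
          rw [← ha' m hm1 (by omega)]
          exact mul_right_cancel₀ (hbh ▸ hbl) (h2 m (by omega) hm2)
        refine flat (c := a l) (e := b l) (fun i => ?_) fun j => ?_
        · rcases pos i with rfl | rfl | hi | hi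
          · exact Or.inr rfl
          · exact Or.inr hah'
          · exact Or.inr ((ha' i hi.1 (by omega)).trans hah')
          · exact Or.inl (ha _ hi)
        · rcases pos j with rfl | rfl | hj | hj
          · exact Or.inr rfl
          · exact Or.inr hbh
          · exact Or.inr (hb' j (by omega) hj.2)
          · exact Or.inl (hb _ hj)

/-- A product array supported on the square of layer `k`, constant on all tiles inside it, and with
sum zero, vanishes. -/
lemma prod_eq_zero_of_const_on_tiles {d : ℕ} {a b : Fin d → ℂ}
    (hsum : (∑ i, a i) * ∑ j, b j = 0)
    (htile : ∀ k ∈ Finset.Icc 1 ((d - 1) / 2), ∀ t p q, InTile d k t p → InTile d k t q →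
      a p.1 * b p.2 = a q.1 * b q.2) (k : ℕ) (hk : k ≤ (d - 1) / 2)
    (ha : ∀ i : Fin d, ¬ (lo d k ≤ i ∧ (i : ℕ) ≤ hi d k) → a i = 0)
    (hb : ∀ i : Fin d, ¬ (lo d k ≤ i ∧ (i : ℕ) ≤ hi d k) → b i = 0) (i j : Fin d) :
    a i * b j = 0 := by
  induction k with
  | zero =>
    by_contra hne
    have flat : ∀ {c : Fin d → ℂ}, (∀ i : Fin d, ¬ (lo d 0 ≤ i ∧ (i : ℕ) ≤ hi d 0) → c i = 0) →
        ∀ {i₀}, c i₀ ≠ 0 → ∑ i, c i ≠ 0 := by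
      intro c hc i₀ h₀
      refine sum_ne_zero_of_flat (c := c i₀) (fun i => ?_) h₀
      -- The square of layer 0 is a single cell, so a vector supported there is flat.
      by_cases h : lo d 0 ≤ i ∧ (i : ℕ) ≤ hi d 0
      · have h' : lo d 0 ≤ i₀ ∧ (i₀ : ℕ) ≤ hi d 0 := by
          by_contra h'
          exact h₀ (hc _ h')
        have : i = i₀ := by
          simp only [lo, hi] at h h'
          exact Fin.ext (by omega)
        exact Or.inr (congrArg c this)
      · exact Or.inl (hc _ h)
    exact mul_ne_zero (flat ha (left_ne_zero_of_mul hne)) (flat hb (right_ne_zero_of_mul hne)) hsum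
  | succ k ih =>
    by_contra hne
    have hkI : k + 1 ∈ Finset.Icc 1 ((d - 1) / 2) := Finset.mem_Icc.2 ⟨by omega, hk⟩
    let l : Fin d := ⟨lo d (k + 1), by unfold lo; omega⟩
    let h : Fin d := ⟨hi d (k + 1), by unfold hi; omega⟩
    have hl : (l : ℕ) = lo d (k + 1) := rfl
    have hh : (h : ℕ) = hi d (k + 1) := rfl
    have hlh : (l : ℕ) + 2 ≤ h := by
      rw [hl, hh]
      unfold lo hi
      omega
    obtain ⟨h1, h2, h3, h4⟩ := boundary_eq_zero hlh ha hb
      (fun j hj hj' => htile _ hkI 0 (l, j) (l, l) ⟨hl, hj, hj'⟩ ⟨hl, le_rfl, by simp only; omega⟩)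
      (fun j hj hj' => htile _ hkI 1 (h, j) (h, h) ⟨hh, hj, hj'⟩ ⟨hh, by simp only; omega, le_rfl⟩)
      (fun i hi hi' => htile _ hkI 2 (i, h) (l, h) ⟨hh, hi, hi'⟩ ⟨hh, le_rfl, by simp only; omega⟩)
      (fun i hi hi' => htile _ hkI 3 (i, l) (h, l) ⟨hl, hi, hi'⟩ ⟨hl, by simp only; omega, le_rfl⟩)
      hsum hne
    -- Once the end values vanish, both factors are supported on the next square inside.
    have shrink : ∀ {c : Fin d → ℂ},
        (∀ i : Fin d, ¬ (lo d (k + 1) ≤ i ∧ (i : ℕ) ≤ hi d (k + 1)) → c i = 0) → c l = 0 →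
        c h = 0 → ∀ i : Fin d, ¬ (lo d k ≤ i ∧ (i : ℕ) ≤ hi d k) → c i = 0 := by
      intro c hc hcl hch i hi'
      by_cases h1 : i = l
      · rw [h1, hcl]
      by_cases h2 : i = h
      · rw [h2, hch]
      refine hc i fun h3 => hi' ?_
      rw [Fin.ext_iff, hl] at h1
      rw [Fin.ext_iff, hh] at h2
      simp only [lo, hi] at h1 h2 h3 ⊢
      omega
    exact hne (ih (by omega) (shrink ha h1 h2) (shrink hb h3 h4))

lemma not_isProductKet_of_mem {d : ℕ} (hodd : Odd d) {v : EuclideanSpace ℂ (Fin d × Fin d)}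
    (hv : v ∈ entangledSubspace d) : ¬ IsProductKet v := by
  rintro ⟨hne, a, b, rfl⟩
  apply hne
  ext p
  refine prod_eq_zero_of_const_on_tiles (a := a) (b := b) ?_ (fun k hk t p q hp hq =>
    const_on_tile_of_mem hodd hv hk hp hq) ((d - 1) / 2) le_rfl ?_ ?_ p.1 p.2
  · have h := sum_eq_zero_of_mem hv
    simp only [prodKet_apply, Fintype.sum_prod_type] at h
    rw [Finset.sum_mul_sum, h]
  -- As `d` is odd, the square of the outermost layer is the whole array.
  all_goals
    intro i hi'
    refine absurd ?_ hi'
    obtain ⟨n, rfl⟩ := hodd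
    have := i.isLt
    simp only [lo, hi]
    omega

lemma isUPB_tilesUPB {d : ℕ} (hodd : Odd d) (hd : 5 ≤ d) : IsUPB (tilesUPB d) where
  product v hv := by
    rw [← range_tilesFamily] at hv
    obtain ⟨x, rfl⟩ := hv
    refine ⟨tilesFamily_ne_zero hodd.pos x, ?_⟩
    match x with
    | none => exact ⟨_, _, rfl⟩
    | some ⟨⟨⟨k, k'⟩, t⟩, hx⟩ => fin_cases t <;> exact ⟨_, _, rfl⟩
  orthogonal v hv w hw hvw := by
    rw [← range_tilesFamily] at hv hw
    obtain ⟨x, rfl⟩ := hv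
    obtain ⟨y, rfl⟩ := hw
    exact tilesFamily_orthogonal d fun h => hvw (congrArg _ h)
  incomplete h := by
    have h1 := finrank_entangledSubspace hodd
    rw [entangledSubspace, h, Submodule.top_orthogonal_eq_bot, finrank_bot] at h1
    omega
  unextendible v hv := not_isProductKet_of_mem hodd hv

/-! ### The states `sigma d k` -/

lemma star_missing (d k : ℕ) (t : Fin 4) (p : Fin d × Fin d) :
    star (missing d k t p) = missing d k t p := by
  rw [missing_apply]
  split_ifs <;> simp

lemma star_squareKet (d k : ℕ) (p : Fin d × Fin d) :
    star (squareKet d k p) = squareKet d k p := by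
  rw [squareKet_apply]
  split_ifs <;> simp

/-- Up to normalization, `sigma d k` is the projector onto the tile states of layer `k` and the
square inside it, minus the projector onto the square of layer `k`. -/
lemma sigma_apply {d k : ℕ} (hd : 0 < d) (hk : k ∈ Finset.Icc 1 ((d - 1) / 2))
    (p q : Fin d × Fin d) :
    sigma d k p q = 1 / 4 * (∑ t, missing d k t p * missing d k t q / (2 * k)
      + squareKet d (k - 1) p * squareKet d (k - 1) q / (2 * k - 1) ^ 2
      - squareKet d k p * squareKet d k q / (2 * k + 1) ^ 2) := by
  have hk0 : (k : ℂ) ≠ 0 := by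
    rw [Finset.mem_Icc] at hk
    exact_mod_cast (by omega : k ≠ 0)
  have h1 := two_mul_sub_one_ne_zero k
  have h2 := two_mul_add_one_ne_zero k
  rw [squareKet_eq hk p, squareKet_eq hk q]
  simp only [sigma, Matrix.smul_apply, Matrix.sum_apply, pureState_apply,
    inner_entKet_self hd hk, smul_eq_mul]
  simp only [Fin.sum_univ_four, entKet, PiLp.add_apply, PiLp.sub_apply, PiLp.smul_apply, smul_eq_mul, star_add,
    star_sub, star_mul', star_missing, star_squareKet, star_pow, star_natCast, star_ofNat, star_one]
  generalize missing d k 0 p = x0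
  generalize missing d k 1 p = x1
  generalize missing d k 2 p = x2
  generalize missing d k 3 p = x3
  generalize missing d k 0 q = y0
  generalize missing d k 1 q = y1
  generalize missing d k 2 q = y2
  generalize missing d k 3 q = y3
  simp only [Fin.reduceEq, if_true, if_false]
  -- The denominators are treated as atoms while clearing fractions; their values in `k` are needed
  -- only for the final identity.
  generalize hu : 2 * (k : ℂ) - 1 = u at h1 ⊢
  generalize hw : 2 * (k : ℂ) + 1 = w at h2 ⊢
  field_simp
  rw [← hu, ← hw]
  ring

/-- By `sigma_apply`, the matrix is a combination of projectors onto real product vectors, and `a i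
* b j' * (a i' * b j)` does not change when `j` and `j'` are exchanged. -/
lemma partialTranspose_sigma {d k : ℕ} (hd : 0 < d) (hk : k ∈ Finset.Icc 1 ((d - 1) / 2)) :
    partialTranspose (sigma d k) = sigma d k := by
  ext p q
  have h : ∀ a b : EuclideanSpace ℂ (Fin d),
      prodKet a b (p.1, q.2) * prodKet a b (q.1, p.2) = prodKet a b p * prodKet a b q := by
    intro a b
    simp only [prodKet_apply]
    ring
  have h' : ∀ t, missing d k t (p.1, q.2) * missing d k t (q.1, p.2) =
      missing d k t p * missing d k t q := by
    intro t
    fin_cases t <;> exact h _ _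
  rw [partialTranspose_apply, sigma_apply hd hk, sigma_apply hd hk]
  simp only [h', squareKet, h]

lemma sigma_eq (d k : ℕ) : sigma d k =
    ((Finset.univ : Finset (Fin 4)).card : ℂ)⁻¹ • ∑ i, pureState (entKet d k i) := by
  rw [sigma, Finset.card_univ, Fintype.card_fin]
  norm_num

lemma sigma_mem_peresSet {d k : ℕ} (hd : 0 < d) (hk : k ∈ Finset.Icc 1 ((d - 1) / 2)) :
    sigma d k ∈ peresSet (Fin d) (Fin d) := by
  have h : IsDensity (sigma d k) := by
    rw [sigma_eq]
    exact isDensity_average _ Finset.univ_nonempty _ fun i _ =>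
      isDensity_pureState (entKet_ne_zero hd hk i)
  exact ⟨h, (partialTranspose_sigma hd hk).symm ▸ h.posSemidef⟩

lemma sigma_mulVec_eq_zero {d k : ℕ} {v : EuclideanSpace ℂ (Fin d × Fin d)}
    (h : ∀ i, inner ℂ (entKet d k i) v = 0) : (sigma d k).mulVec v = 0 := by
  rw [sigma, Matrix.smul_mulVec, sum_pureState_mulVec_eq_zero _ _ fun i _ => h i, smul_zero]

lemma sigma_mulVec_tilesUPB {d k : ℕ} (hd : 0 < d) (hk : k ∈ Finset.Icc 1 ((d - 1) / 2))
    {u : EuclideanSpace ℂ (Fin d × Fin d)} (hu : u ∈ tilesUPB d) : (sigma d k).mulVec u = 0 :=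
  sigma_mulVec_eq_zero fun i => inner_eq_zero_symm.1 (inner_entKet_tilesUPB hd hk i hu)

lemma rank_sigma {d k : ℕ} (hd : 0 < d) (hk : k ∈ Finset.Icc 1 ((d - 1) / 2)) :
    (sigma d k).rank = 4 := by
  -- The scalar is written as an invertible matrix, which preserves the rank.
  have h : sigma d k = (Matrix.diagonal fun _ => (1 / 4 : ℂ)) * ∑ i, pureState (entKet d k i) := by
    rw [sigma, ← Matrix.smul_eq_diagonal_mul]
  rw [h, Matrix.rank_mul_eq_right_of_isUnit_det, rank_sum_pureState _ (entKet_ne_zero hd hk)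
    (fun i j hij => entKet_orthogonal hk hij), Fintype.card_fin]
  rw [Matrix.det_diagonal, isUnit_iff_ne_zero]
  simp

lemma rho_eq {d : ℕ} (hodd : Odd d) :
    rho d = ((2 * (d - 1) : ℕ) : ℂ)⁻¹ • ∑ k ∈ Finset.Icc 1 ((d - 1) / 2), ∑ i,
      pureState (entKet d k i) := by
  rw [rho, ← span_entFamily hodd, normalizedProjector_span _ (entFamily_ne_zero hodd.pos)
    (entFamily_orthogonal hodd.pos), card_entFamily hodd, Fintype.sum_prod_type,
    ← Finset.sum_coe_sort (Finset.Icc 1 ((d - 1) / 2)) fun k => ∑ i, pureState (entKet d k i)]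
  rfl

lemma rho_eq_average {d : ℕ} (hodd : Odd d) :
    rho d = ((Finset.Icc 1 ((d - 1) / 2)).card : ℂ)⁻¹ •
      ∑ k ∈ Finset.Icc 1 ((d - 1) / 2), sigma d k := by
  rw [rho_eq hodd]
  simp only [sigma]
  rw [← Finset.smul_sum, smul_smul]
  congr 1
  obtain ⟨n, rfl⟩ := hodd
  have h1 : (2 * n + 1 - 1) / 2 = n := by omega
  have h2 : 2 * n + 1 - 1 = 2 * n := by omega
  rw [h1, h2, Nat.card_Icc]
  simp only [Nat.add_sub_cancel, Nat.cast_mul, mul_inv]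
  push_cast
  ring

/-! ### Extremality -/

/-- The five regions of the square of layer `k`: its four tiles and the square inside it. -/
def InRegion (d k : ℕ) : Option (Fin 4) → Fin d × Fin d → Prop
  | none => InSquare d (k - 1)
  | some t => InTile d k t

/-- The indicator vectors of the five regions. -/
def regionKet (d k : ℕ) : Option (Fin 4) → EuclideanSpace ℂ (Fin d × Fin d)
  | none => squareKet d (k - 1)
  | some t => missing d k t

open Classical in
lemma regionKet_apply (d k : ℕ) (X : Option (Fin 4)) (p : Fin d × Fin d) :
    regionKet d k X p = if InRegion d k X p then 1 else 0 := by
  match X with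
  | none => exact (squareKet_apply _ _ _).trans (if_congr Iff.rfl rfl rfl)
  | some t => exact (missing_apply _ _ _ _).trans (if_congr Iff.rfl rfl rfl)

lemma squareKet_eq_sum_regionKet {d k : ℕ} (hk : k ∈ Finset.Icc 1 ((d - 1) / 2))
    (p : Fin d × Fin d) : squareKet d k p = ∑ X, regionKet d k X p := by
  rw [squareKet_eq hk, Fintype.sum_option, Fin.sum_univ_four, add_comm]
  rfl

/-- The number of cells of a region. -/
def regionSize (k : ℕ) : Option (Fin 4) → ℂ
  | none => (2 * k - 1) ^ 2
  | some _ => 2 * k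

lemma sum_regionKet {d k : ℕ} (hd : 0 < d) (hk : k ∈ Finset.Icc 1 ((d - 1) / 2))
    (X : Option (Fin 4)) : ∑ p, regionKet d k X p = regionSize k X := by
  have h : inner ℂ (regionKet d k X) (regionKet d k X) = regionSize k X := by
    match X with
    | none => exact inner_squareKet_pred_self hd hk
    | some t => exact inner_missing_self hk t
  rw [← h, inner_eq_sum]
  refine Finset.sum_congr rfl fun p _ => ?_
  rw [regionKet_apply]
  split_ifs <;> simp

lemma exists_inRegion {d k : ℕ} (hk : k ∈ Finset.Icc 1 ((d - 1) / 2)) {p : Fin d × Fin d}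
    (hp : InSquare d k p) : ∃ X, InRegion d k X p := by
  by_contra! h
  have h1 := squareKet_eq_sum_regionKet hk p
  rw [squareKet_apply, if_pos hp, Finset.sum_eq_zero fun X _ => by
    rw [regionKet_apply, if_neg (h X)]] at h1
  exact one_ne_zero h1

/-- A matrix whose columns are constant on each of the five regions of a square. -/
def ColumnsConst (d k : ℕ) (D : Matrix (Fin d × Fin d) (Fin d × Fin d) ℂ) : Prop :=
  ∀ X p q, InRegion d k X p → InRegion d k X q → ∀ r, D r p = D r q

/-- A traceless Hermitian matrix on the square of layer `k` which annihilates the constant vector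
and is, like its partial transpose, constant on regions, vanishes. -/
lemma eq_zero_of_columnsConst {d k : ℕ} (hd : 0 < d) (hk : k ∈ Finset.Icc 1 ((d - 1) / 2))
    {D : Matrix (Fin d × Fin d) (Fin d × Fin d) ℂ} (hherm : D.IsHermitian)
    (hΓherm : (partialTranspose D).IsHermitian)
    (hD : ColumnsConst d k D) (hΓ : ColumnsConst d k (partialTranspose D))
    (hout : ∀ r p, ¬ InSquare d k p → D r p = 0)
    (hker : D.mulVec (squareKet d k) = 0) (htr : D.trace = 0) : D = 0 := by
  have hk' := Finset.mem_Icc.1 hk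
  have const : ∀ {E : Matrix (Fin d × Fin d) (Fin d × Fin d) ℂ}, E.IsHermitian →
      ColumnsConst d k E → ∀ {X Y p p' q q'}, InRegion d k X p → InRegion d k X p' →
      InRegion d k Y q → InRegion d k Y q' → E p q = E p' q' := by
    intro E hE hE' X Y p p' q q' hp hp' hq hq'
    rw [hE' Y q q' hq hq' p, ← hE.apply, ← hE.apply p' q', hE' X p p' hp hp' q']
  -- The nine cells with coordinates among first, middle and last index meet all five regions.
  let l : Fin d := ⟨lo d k, by unfold lo; omega⟩
  let m : Fin d := ⟨(d - 1) / 2, by omega⟩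
  let h : Fin d := ⟨hi d k, by unfold hi; omega⟩
  have ll : InRegion d k (some 0) (l, l) := by simp [InRegion, InTile, l, lo, hi]; omega
  have lm : InRegion d k (some 0) (l, m) := by simp [InRegion, InTile, l, m, lo, hi]; omega
  have hh : InRegion d k (some 1) (h, h) := by simp [InRegion, InTile, h, lo, hi]; omega
  have hm : InRegion d k (some 1) (h, m) := by simp [InRegion, InTile, h, m, lo, hi]; omega
  have lh : InRegion d k (some 2) (l, h) := by simp [InRegion, InTile, l, h, lo, hi]; omega
  have mh : InRegion d k (some 2) (m, h) := by simp [InRegion, InTile, m, h, lo, hi]; omega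
  have hl : InRegion d k (some 3) (h, l) := by simp [InRegion, InTile, l, h, lo, hi]; omega
  have ml : InRegion d k (some 3) (m, l) := by simp [InRegion, InTile, m, l, lo, hi]; omega
  have mm : InRegion d k none (m, m) := by simp [InRegion, InSquare, m, lo, hi]
  let rep : Option (Fin 4) → Fin d × Fin d := fun X =>
    X.elim (m, m) ![(l, l), (h, h), (l, h), (h, l)]
  have hrep : ∀ X, InRegion d k X (rep X) := by
    rintro (_ | t)
    · exact mm
    · fin_cases t
      exacts [ll, hh, lh, hl]
  let M : Option (Fin 4) → Option (Fin 4) → ℂ := fun X Y => D (rep X) (rep Y)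
  let N : Option (Fin 4) → Option (Fin 4) → ℂ := fun X Y => partialTranspose D (rep X) (rep Y)
  have hM : ∀ {X Y p q}, InRegion d k X p → InRegion d k Y q → D p q = M X Y := fun hp hq =>
    const hherm hD hp (hrep _) hq (hrep _)
  -- Each choice of four indices identifies an entry of `M` with one of `N`. Different cells of the
  -- same two regions `X`, `Y` may lead to different `X'`, `Y'`, and thereby equate entries of `M`.
  have key : ∀ {X Y X' Y'} {i j i' j' : Fin d}, InRegion d k X (i, j) → InRegion d k Y (i', j') →
      InRegion d k X' (i, j') → InRegion d k Y' (i', j) → M X' Y' = N X Y :=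
    fun h1 h2 h3 h4 => (hM h3 h4).symm.trans (const hΓherm hΓ h1 (hrep _) h2 (hrep _))
  have hMstar : ∀ X Y, star (M X Y) = M Y X := fun X Y => hherm.apply _ _
  set x := M (some 0) (some 1) with hx
  have e01 : x = N (some 0) (some 1) := key lm hm lm hm
  have e03 : M (some 0) (some 3) = x := (key ll hm lm hl).trans e01.symm
  have e23 : M (some 2) (some 3) = x := (key ll hh lh hl).trans e01.symm
  have e21 : M (some 2) (some 1) = x := (key lm hh lh hm).trans e01.symm
  -- The pair of corners `(l, h)`, `(h, l)` ties the entry of `N` for tiles 2 and 3 to the same `x`.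
  have e01' : x = N (some 2) (some 3) := key lh hl ll hh
  have e02 : M (some 0) (some 2) = x := (key lh ml ll mh).trans e01'.symm
  have e32 : M (some 3) (some 2) = x := (key mh ml ml mh).trans e01'.symm
  have e31 : M (some 3) (some 1) = x := (key mh hl ml hh).trans e01'.symm
  -- The entries for tiles (2, 3) and (3, 2) are both `x` and are conjugate to each other.
  have hreal : star x = x := by
    conv_lhs => rw [← e23]
    rw [hMstar, e32]
  have flip : ∀ {X Y}, M X Y = x → M Y X = x := by
    intro X Y h
    rw [← hMstar, h, hreal]
  have e12 : M (some 1) (some 2) = x := flip e21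
  have e13 : M (some 1) (some 3) = x := flip e31
  have e04 : M (some 0) none = x := (key lm mm lm mm).trans ((key ll mm lm ml).symm.trans e03)
  have e14 : M (some 1) none = x := (key hm mm hm mm).trans ((key hh mm hm mh).symm.trans e12)
  have e42 : M none (some 2) = x := (key mh mm mm mh).trans ((key lh mm lm mh).symm.trans e02)
  have e43 : M none (some 3) = x := (key ml mm mm ml).trans ((key hl mm hm ml).symm.trans e13)
  have off : ∀ X Y, Y ≠ X → M X Y = x := by
    rintro (_ | X) (_ | Y) hXY
    · exact absurd rfl hXY
    · fin_cases Y
      exacts [flip e04, flip e14, e42, e43]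
    · fin_cases X
      exacts [e04, e14, flip e42, flip e43]
    · fin_cases X <;> fin_cases Y <;> first
        | exact absurd rfl hXY
        | assumption
        | (apply flip; assumption)
  have hsize : ∑ Y, regionSize k Y = (2 * k + 1) ^ 2 := by
    simp only [Fintype.sum_option, regionSize, Fin.sum_univ_four]
    ring
  have hsum : ∀ X, ∑ Y, M X Y * regionSize k Y = 0 := by
    intro X
    have h1 := congrFun hker (rep X)
    simp only [Matrix.mulVec, dotProduct, Pi.zero_apply, squareKet_eq_sum_regionKet hk,
      Finset.mul_sum] at h1
    rw [Finset.sum_comm] at h1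
    rw [← h1]
    refine Finset.sum_congr rfl fun Y _ => ?_
    rw [← sum_regionKet hd hk, Finset.mul_sum]
    refine Finset.sum_congr rfl fun p _ => ?_
    rw [regionKet_apply]
    split_ifs with hp
    · rw [hM (hrep X) hp]
    · simp
  -- In a weighted row sum equal to zero, all entries but the diagonal one are `x`.
  have hdiag : ∀ X, M X X * regionSize k X = x * (regionSize k X - (2 * k + 1) ^ 2) := by
    intro X
    have h1 := hsum X
    rw [← Finset.add_sum_erase _ _ (Finset.mem_univ X), Finset.sum_congr rfl fun Y hY => by
      rw [off X Y (Finset.ne_of_mem_erase hY)], ← Finset.mul_sum] at h1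
    have h2 := Finset.add_sum_erase _ (regionSize k) (Finset.mem_univ X)
    rw [hsize] at h2
    linear_combination h1 - x * h2
  have htr' : ∑ X, M X X * regionSize k X = 0 := by
    rw [← htr, Matrix.trace]
    have h1 : ∀ p, D.diag p = ∑ X, D p p * regionKet d k X p := by
      intro p
      rw [← Finset.mul_sum, ← squareKet_eq_sum_regionKet hk, squareKet_apply, Matrix.diag_apply]
      split_ifs with hp
      · rw [mul_one]
      · rw [hout _ _ hp, zero_mul]
    rw [Finset.sum_congr rfl fun p _ => h1 p, Finset.sum_comm]
    refine Finset.sum_congr rfl fun X _ => ?_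
    rw [← sum_regionKet hd hk, Finset.mul_sum]
    refine Finset.sum_congr rfl fun p _ => ?_
    rw [regionKet_apply]
    split_ifs with hp
    · rw [hM hp hp]
    · simp
  -- Summing the diagonal relation over the five regions gives `x * ((2k + 1)^2 - 5 (2k + 1)^2)`,
  -- which the zero trace annihilates.
  have hx0 : x = 0 := by
    rw [Finset.sum_congr rfl fun X _ => hdiag X, ← Finset.mul_sum, Finset.sum_sub_distrib, hsize,
      Finset.sum_const, Finset.card_univ, Fintype.card_option, Fintype.card_fin, nsmul_eq_mul]
      at htr'
    have h1 := two_mul_add_one_ne_zero k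
    have h2 : (-4 * (2 * (k : ℂ) + 1) ^ 2) * x = 0 := by
      rw [← htr']
      push_cast
      ring
    refine (mul_eq_zero.1 h2).resolve_left (mul_ne_zero (by norm_num) (pow_ne_zero _ h1))
  have hsize0 : ∀ X, regionSize k X ≠ 0 := by
    rintro (_ | t)
    · exact pow_ne_zero _ (two_mul_sub_one_ne_zero k)
    · simp only [regionSize]
      exact_mod_cast (by omega : 2 * k ≠ 0)
  have hM0 : ∀ X Y, M X Y = 0 := by
    intro X Y
    by_cases hXY : Y = X
    · have h1 := hdiag X
      rw [hx0, zero_mul] at h1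
      rw [hXY]
      exact (mul_eq_zero.1 h1).resolve_right (hsize0 X)
    · rw [off X Y hXY, hx0]
  ext p q
  rw [Matrix.zero_apply]
  by_cases hq : InSquare d k q
  · by_cases hp : InSquare d k p
    · obtain ⟨X, hX⟩ := exists_inRegion hk hp
      obtain ⟨Y, hY⟩ := exists_inRegion hk hq
      rw [hM hX hY, hM0]
    · rw [← hherm.apply, hout _ _ hp, star_zero]
  · exact hout _ _ hq

lemma mulVec_single_sub_single {m : Type*} [Fintype m] [DecidableEq m] (A : Matrix m m ℂ)
    (p q r : m) : A.mulVec (Pi.single p 1 - Pi.single q 1) r = A r p - A r q := by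
  simp [Matrix.mulVec_sub]

/-- A component of a mixture inherits the equality of columns. -/
lemma columnsConst_of_mixture {d k : ℕ} {A B : Matrix (Fin d × Fin d) (Fin d × Fin d) ℂ}
    (hA : A.PosSemidef) (hB : B.PosSemidef) {a b : ℝ} (ha : 0 < a) (hb : 0 < b)
    (h : ColumnsConst d k (a • A + b • B)) : ColumnsConst d k A := by
  intro X p q hp hq r
  -- Equality of two columns is a statement about the kernel, and the kernel of a mixture passes to
  -- its components.
  have h1 : (a • A + b • B).mulVec (Pi.single p 1 - Pi.single q 1) = 0 := by
    ext s
    rw [mulVec_single_sub_single, h X p q hp hq s, sub_self, Pi.zero_apply]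
  have h2 := congrFun (mulVec_eq_zero_of_mixture hA hB ha hb h1) r
  rw [mulVec_single_sub_single, Pi.zero_apply] at h2
  exact sub_eq_zero.1 h2

/-- By `sigma_apply`, a column depends on its cell only through the indicators of the regions, and
these are disjoint. -/
lemma columnsConst_sigma {d k : ℕ} (hd : 0 < d) (hk : k ∈ Finset.Icc 1 ((d - 1) / 2)) :
    ColumnsConst d k (sigma d k) := by
  have hk' := Finset.mem_Icc.1 hk
  intro X p q hp hq r
  have h : ∀ Y, regionKet d k Y p = regionKet d k Y q := by
    intro Y
    have : InRegion d k Y p ↔ InRegion d k Y q := by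
      match X, Y with
      | none, none => exact ⟨fun _ => hq, fun _ => hp⟩
      | some t, none =>
        have : k - 1 ≤ (d - 1) / 2 := by omega
        exact (inSquare_iff_of_inTile this hk hp).trans (inSquare_iff_of_inTile this hk hq).symm
      | some t, some s =>
        constructor
        · intro h
          exact (inTile_disjoint hk hk hp h).2 ▸ hq
        · intro h
          exact (inTile_disjoint hk hk hq h).2 ▸ hp
      | none, some s =>
        have : k - 1 ≤ (d - 1) / 2 := by omega
        constructor
        · intro h
          have := (inSquare_iff_of_inTile this hk h).1 hp
          omega
        · intro h
          have := (inSquare_iff_of_inTile this hk h).1 hq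
          omega
    classical
    rw [regionKet_apply, regionKet_apply, if_congr this rfl rfl]
  have hm : ∀ t, missing d k t p = missing d k t q := fun t => h (some t)
  have hs : squareKet d (k - 1) p = squareKet d (k - 1) q := h none
  have hs' : squareKet d k p = squareKet d k q := by
    rw [squareKet_eq_sum_regionKet hk, squareKet_eq_sum_regionKet hk]
    exact Finset.sum_congr rfl fun Y _ => h Y
  rw [sigma_apply hd hk, sigma_apply hd hk, hs, hs']
  simp only [hm]

lemma sigma_apply_of_not_inSquare {d k : ℕ} (hk : k ∈ Finset.Icc 1 ((d - 1) / 2))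
    {p : Fin d × Fin d} (hp : ¬ InSquare d k p) (r : Fin d × Fin d) : sigma d k r p = 0 := by
  rw [sigma, Matrix.smul_apply, Matrix.sum_apply, Finset.sum_eq_zero, smul_zero]
  intro i _
  rw [pureState_apply, entKet_apply_of_not_inSquare hk i hp, star_zero, mul_zero, mul_zero]

/-- Any Peres state which is a component of `sigma d k` equals it. -/
lemma eq_sigma_of_mixture {d k : ℕ} (hd : 0 < d) (hk : k ∈ Finset.Icc 1 ((d - 1) / 2))
    {A B : Matrix (Fin d × Fin d) (Fin d × Fin d) ℂ} (hA : A ∈ peresSet (Fin d) (Fin d))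
    (hB : B ∈ peresSet (Fin d) (Fin d)) {a b : ℝ} (ha : 0 < a) (hb : 0 < b)
    (h : a • A + b • B = sigma d k) : A = sigma d k := by
  have hσ := sigma_mem_peresSet hd hk
  -- As `sigma d k` is its own partial transpose, the partial transposes of `A` and `B` mix to the
  -- same state, and the kernel argument applies to them as well.
  have hΓ : a • partialTranspose A + b • partialTranspose B = sigma d k := by
    rw [← partialTranspose_sigma hd hk, ← h]
    rfl
  have hAP := hA.1.posSemidef
  have hBP := hB.1.posSemidef
  have sub : ∀ {E : Matrix (Fin d × Fin d) (Fin d × Fin d) ℂ}, ColumnsConst d k E →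
      ColumnsConst d k (E - sigma d k) := by
    intro E hE X p q hp hq r
    rw [Matrix.sub_apply, Matrix.sub_apply, hE X p q hp hq r,
      columnsConst_sigma hd hk X p q hp hq r]
  have hΓsub : partialTranspose (A - sigma d k) = partialTranspose A - sigma d k := by
    conv_rhs => rw [← partialTranspose_sigma hd hk]
    rfl
  refine sub_eq_zero.1 (eq_zero_of_columnsConst hd hk (D := A - sigma d k) ?_ ?_ ?_ ?_ ?_ ?_ ?_)
  · exact hAP.isHermitian.sub hσ.1.posSemidef.isHermitian
  · rw [hΓsub]
    exact hA.2.isHermitian.sub hσ.1.posSemidef.isHermitian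
  · exact sub (columnsConst_of_mixture hAP hBP ha hb (h ▸ columnsConst_sigma hd hk))
  · rw [hΓsub]
    exact sub (columnsConst_of_mixture hA.2 hB.2 ha hb (hΓ ▸ columnsConst_sigma hd hk))
  · intro r p hp
    have h1 : (a • A + b • B).mulVec (Pi.single p 1) = 0 := by
      rw [h, Matrix.mulVec_single_one]
      ext s
      exact sigma_apply_of_not_inSquare hk hp s
    have h2 := congrFun (mulVec_eq_zero_of_mixture hAP hBP ha hb h1) r
    rw [Matrix.mulVec_single_one] at h2
    rw [Matrix.sub_apply, sigma_apply_of_not_inSquare hk hp, sub_zero]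
    exact h2
  · have h1 : (sigma d k).mulVec (squareKet d k) = 0 :=
      sigma_mulVec_eq_zero fun i => inner_eq_zero_symm.1 (inner_squareKet_entKet hd hk i)
    rw [Matrix.sub_mulVec, h1, sub_zero]
    exact mulVec_eq_zero_of_mixture hAP hBP ha hb (h.symm ▸ h1)
  · rw [Matrix.trace_sub, hA.1.trace_eq_one, hσ.1.trace_eq_one, sub_self]

lemma sigma_mem_extremePoints {d k : ℕ} (hd : 0 < d) (hk : k ∈ Finset.Icc 1 ((d - 1) / 2)) :
    sigma d k ∈ (peresSet (Fin d) (Fin d)).extremePoints ℝ := by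
  rw [mem_extremePoints]
  refine ⟨sigma_mem_peresSet hd hk, ?_⟩
  rintro A hA B hB ⟨a, b, ha, hb, -, h⟩
  exact ⟨eq_sigma_of_mixture hd hk hA hB ha hb h,
    eq_sigma_of_mixture hd hk hB hA hb ha ((add_comm _ _).trans h)⟩

end TilesUPB

end

/-! ### The theorem assembled. -/

theorem theorem2 (d : ℕ) (hodd : Odd d) (hd : 5 ≤ d) :
    TilesUPB.IsUPB (TilesUPB.tilesUPB d) ∧
    (TilesUPB.tilesUPB d).ncard = (d - 1) ^ 2 + 1 ∧
    Module.finrank ℂ (TilesUPB.entangledSubspace d) = 2 * (d - 1) ∧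
    TilesUPB.IsPPTBoundEntangled (TilesUPB.rho d) ∧
    TilesUPB.rho d =
      (2 / ((d : ℂ) - 1)) • ∑ k ∈ Finset.Icc 1 ((d - 1) / 2), TilesUPB.sigma d k ∧
    ∀ k ∈ Finset.Icc 1 ((d - 1) / 2),
      (TilesUPB.sigma d k).rank = 4 ∧
      TilesUPB.IsPPTBoundEntangled (TilesUPB.sigma d k) ∧
      TilesUPB.sigma d k ∈ (TilesUPB.peresSet (Fin d) (Fin d)).extremePoints ℝ := by
  have hUPB := TilesUPB.isUPB_tilesUPB hodd hd
  refine ⟨hUPB, TilesUPB.ncard_tilesUPB hodd, TilesUPB.finrank_entangledSubspace hodd, ?_, ?_,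
    fun k hk => ⟨TilesUPB.rank_sigma hodd.pos hk, ⟨TilesUPB.sigma_mem_peresSet hodd.pos hk,
      hUPB.not_isSeparable fun u hu => TilesUPB.sigma_mulVec_tilesUPB hodd.pos hk hu⟩,
      TilesUPB.sigma_mem_extremePoints hodd.pos hk⟩⟩
  · rw [TilesUPB.rho_eq_average hodd]
    refine ⟨TilesUPB.average_mem_peresSet _ (Finset.nonempty_Icc.2 (by omega)) _ fun k hk =>
      TilesUPB.sigma_mem_peresSet hodd.pos hk, hUPB.not_isSeparable fun u hu => ?_⟩
    rw [Matrix.smul_mulVec, Matrix.sum_mulVec, Finset.sum_eq_zero fun k hk =>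
      TilesUPB.sigma_mulVec_tilesUPB hodd.pos hk hu, smul_zero]
  · rw [TilesUPB.rho_eq_average hodd]
    congr 1
    obtain ⟨n, rfl⟩ := hodd
    rw [Nat.card_Icc, show (2 * n + 1 - 1) / 2 + 1 - 1 = n by omega]
    push_cast
    rw [add_sub_cancel_right, div_mul_eq_div_div, div_self two_ne_zero, one_div]
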